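/- Let $\Omega_x,\Omega_y\subset\mathbb R$ be bounded domains (non-empty, open, connected), $\Omega=\Omega_x\times\Omega_y$, and $f\in L^2(\Omega)$. Equip $H^1_0(\Omega)$ with $\langle u,v\rangle=\int_\Omega\nabla u\cdot\nabla v$ and $\|u\|^2=\langle u,u\rangle$, and let $g\in H^1_0(\Omega)$ be the weak solution of $-\Delta g=f$ in $\Omega$, $g=0$ on $\partial\Omega$. Write $(r\otimes s)(x,y)=r(x)s(y)$. The orthogonal greedy algorithm (run without a stopping test) sets $f_0^o=f$ and, for $n\ge 1$, performs the following steps. 1. Choose $(r_n^o,s_n^o)\in H^1_0(\Omega_x)\times H^1_0(\Omega_y)$ minimizing $$(r,s)\mapsto \tfrac12\int_\Omega|\nabla(r\otimes s)|^2-\int_\Omega f_{n-1}^o\,r\otimes s \qquad (\ast)$$ over $H^1_0(\Omega_x)\times H^1_0(\Omega_y)$. 2. Choose $(\alpha_1^{(n)},\dots,\alpha_n^{(n)})\in\mathbb R^n$ minimizing $$(\beta_1,\dots,\beta_n)\mapsto\tfrac12\int_\Omega\Big|\nabla\sum_{k=1}^n\beta_k r_k^o\otimes s_k^o\Big|^2-\int_\Omega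 f\sum_{k=1}^n\beta_k r_k^o\otimes s_k^o$$ over $\mathbb R^n$. 3. Set $f_n^o=f+\Delta\big(\sum_{k=1}^n\alpha_k^{(n)}r_k^o\otimes s_k^o\big)\in H^{-1}(\Omega)$. Here $\int_\Omega f_{n}^o v$ denotes the duality pairing of $H^{-1}(\Omega)$ and $H^1_0(\Omega)$. Put $$E_n^o=\tfrac12\int_\Omega|\nabla(r_n^o\otimes s_n^o)|^2-\int_\Omega f_{n-1}^o\,r_n^o\otimes s_n^o,\qquad g_n^o=g-\sum_{k=1}^n\alpha_k^{(n)}r_k^o\otimes s_k^o .$$ (i) Assume only that in step 1 the pair $(r_n^o,s_n^o)\in H^1_0(\Omega_x)\times H^1_0(\Omega_y)$ satisfies, for every $n\ge1$, the Euler–Lagrange equations of $(\ast)$: for all $(r,s)\in H^1_0(\Omega_x)\times H^1_0(\Omega_y)$, $$\int_\Omega\nabla(r_n^o\otimes s_n^o)\cdot\nabla(r_n^o\otimes s+r\otimes s_n^o)=\int_\Omega f_{n-1}^o\,(r_n^o\otimes s+r\otimes s_n^o),$$ steps 2 and 3 being unchanged. Then every $r_n^o\otimes s_n^o$ belongs to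 $H^1_0(\Omega)$, both series below converge, and $$\sum_{n\ge1}\int_\Omega|\nabla(r_n^o\otimes s_n^o)|^2=-2\sum_{n\ge1}E_n^o<\infty .$$ (ii) If in step 1 each $(r_n^o,s_n^o)$ is a minimizer of $(\ast)$, then $g_n^o\in H^1_0(\Omega)$ for all $n$ and $g_n^o\to0$ strongly in $H^1_0(\Omega)$, that is, $\|g_n^o\|\to0$. Both parts hold for every admissible choice of the (possibly non-unique) pairs $(r_n^o,s_n^o)$ and coefficients $\alpha^{(n)}$. -/

import Mathlib

open MeasureTheory Filter Topology
open scoped ContDiff ENNReal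

noncomputable section

namespace GreedyPoisson

section Sobolev

variable {E : Type*} [NormedAddCommGroup E] [NormedSpace ℝ E] [MeasureSpace E]

/-- `φ ∈ C_c^∞(Ω)`: smooth, with compact support contained in `Ω`. -/
def IsTestFunction (Ω : Set E) (φ : E → ℝ) : Prop :=
  ContDiff ℝ ∞ φ ∧ HasCompactSupport φ ∧ tsupport φ ⊆ Ω

/-- `w` is, on `Ω`, the derivative of `u` in the direction `v` in the sense of distributions. -/
def IsWeakDeriv (Ω : Set E) (v : E) (u w : E → ℝ) : Prop :=
  ∀ φ : E → ℝ, IsTestFunction Ω φ →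
    ∫ z in Ω, u z * fderiv ℝ φ z v = -∫ z in Ω, w z * φ z

/-- `u ∈ H¹(Ω)`: `u` and all its distributional directional derivatives are in `L²(Ω)`. -/
def MemH1 (Ω : Set E) (u : E → ℝ) : Prop :=
  MemLp u 2 (volume.restrict Ω) ∧
    ∀ v : E, ∃ w : E → ℝ, MemLp w 2 (volume.restrict Ω) ∧ IsWeakDeriv Ω v u w

open Classical in
/-- The distributional derivative of `u` on `Ω` in the direction `v`, as an element of `L²(Ω)`
(unique up to equality almost everywhere in `Ω`); the zero function if there is none. -/
def weakDeriv (Ω : Set E) (v : E) (u : E → ℝ) : E → ℝ :=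
  if h : ∃ w : E → ℝ, MemLp w 2 (volume.restrict Ω) ∧ IsWeakDeriv Ω v u w then h.choose else 0

/-- `u ∈ H¹₀(Ω)`: `u` is in the closure of `C_c^∞(Ω)` in `H¹(Ω)`. -/
def MemH10 (Ω : Set E) (u : E → ℝ) : Prop :=
  MemH1 Ω u ∧ ∃ φ : ℕ → E → ℝ, (∀ k, IsTestFunction Ω (φ k)) ∧
    Tendsto (fun k => eLpNorm (fun z => φ k z - u z) 2 (volume.restrict Ω)) atTop (𝓝 0) ∧
    ∀ v : E, Tendsto
      (fun k => eLpNorm (fun z => fderiv ℝ (φ k) z v - weakDeriv Ω v u z) 2 (volume.restrict Ω))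
      atTop (𝓝 0)

end Sobolev

/-- `r ⊗ s`. -/
def tensor (r s : ℝ → ℝ) : ℝ × ℝ → ℝ := fun z => r z.1 * s z.2

/-- `⟨u, v⟩ = ∫_Ω ∇u · ∇v`. -/
def dirichletInner (Ω : Set (ℝ × ℝ)) (u v : ℝ × ℝ → ℝ) : ℝ :=
  ∫ z in Ω, (weakDeriv Ω (1, 0) u z * weakDeriv Ω (1, 0) v z +
    weakDeriv Ω (0, 1) u z * weakDeriv Ω (0, 1) v z)

/-- `‖u‖ = (∫_Ω |∇u|²)^{1/2}`. -/
def dirichletNorm (Ω : Set (ℝ × ℝ)) (u : ℝ × ℝ → ℝ) : ℝ :=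
  Real.sqrt (dirichletInner Ω u u)

/-- `g` is the weak solution in `H¹₀(Ω)` of `-Δg = f` in `Ω`, `g = 0` on `∂Ω`. -/
def IsDirichletSolution (Ω : Set (ℝ × ℝ)) (f g : ℝ × ℝ → ℝ) : Prop :=
  MemH10 Ω g ∧ ∀ v, MemH10 Ω v → dirichletInner Ω g v = ∫ z in Ω, f z * v z

/-- The functional `f + Δu ∈ H⁻¹(Ω)`, acting on `v ∈ H¹₀(Ω)`, where `u ∈ H¹₀(Ω)`. -/
def residual (Ω : Set (ℝ × ℝ)) (f u v : ℝ × ℝ → ℝ) : ℝ :=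
  (∫ z in Ω, f z * v z) - dirichletInner Ω u v

/-- `½ ∫_Ω |∇v|² - F(v)` for a functional `F` on `H¹₀(Ω)`. -/
def energy (Ω : Set (ℝ × ℝ)) (F : (ℝ × ℝ → ℝ) → ℝ) (v : ℝ × ℝ → ℝ) : ℝ :=
  (1 / 2) * dirichletInner Ω v v - F v

/-- `∑_{k < n} β_k r_k ⊗ s_k`. -/
def tensorSum (r s : ℕ → ℝ → ℝ) (β : ℕ → ℝ) (n : ℕ) : ℝ × ℝ → ℝ :=
  fun z => ∑ k ∈ Finset.range n, β k * tensor (r k) (s k) z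

/-- The residual `f_n^o = f + Δ (∑_{k < n} α_{n,k} r_k ⊗ s_k)` after `n` steps. Steps are numbered
from `0`: step `n` selects `(r n, s n)` from the residual after the `n` steps `0, …, n - 1`, and
`α n k`, `k < n`, are the Galerkin coefficients computed after these `n` steps. -/
def stepResidual (Ω : Set (ℝ × ℝ)) (f : ℝ × ℝ → ℝ) (r s : ℕ → ℝ → ℝ) (α : ℕ → ℕ → ℝ) (n : ℕ) :
    (ℝ × ℝ → ℝ) → ℝ :=
  residual Ω f (tensorSum r s (α n) n)

/-- The energy `E_n^o` of step `n`. -/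
def stepEnergy (Ω : Set (ℝ × ℝ)) (f : ℝ × ℝ → ℝ) (r s : ℕ → ℝ → ℝ) (α : ℕ → ℕ → ℝ) (n : ℕ) : ℝ :=
  energy Ω (stepResidual Ω f r s α n) (tensor (r n) (s n))

/-- For every `n`, `(α n k)_{k < n}` is a minimizer over `β ∈ ℝⁿ` of the energy
`½ ∫_Ω |∇ ∑ β_k r_k ⊗ s_k|² - ∫_Ω f ∑ β_k r_k ⊗ s_k`. -/
def IsGalerkin (Ω : Set (ℝ × ℝ)) (f : ℝ × ℝ → ℝ) (r s : ℕ → ℝ → ℝ) (α : ℕ → ℕ → ℝ) : Prop :=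
  ∀ (n : ℕ) (β : ℕ → ℝ),
    energy Ω (fun v => ∫ z in Ω, f z * v z) (tensorSum r s (α n) n) ≤
      energy Ω (fun v => ∫ z in Ω, f z * v z) (tensorSum r s β n)

/-- The orthogonal greedy algorithm in which each `(r n, s n)` only solves the Euler–Lagrange
equations of the minimization problem of step `n`. -/
structure IsEulerLagrangeOGA (Ωx Ωy : Set ℝ) (f : ℝ × ℝ → ℝ) (r s : ℕ → ℝ → ℝ)
    (α : ℕ → ℕ → ℝ) : Prop where
  mem_r : ∀ n, MemH10 Ωx (r n)
  mem_s : ∀ n, MemH10 Ωy (s n)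
  euler_lagrange : ∀ n, ∀ p q : ℝ → ℝ, MemH10 Ωx p → MemH10 Ωy q →
    dirichletInner (Ωx ×ˢ Ωy) (tensor (r n) (s n)) (tensor (r n) q + tensor p (s n)) =
      stepResidual (Ωx ×ˢ Ωy) f r s α n (tensor (r n) q + tensor p (s n))
  galerkin : IsGalerkin (Ωx ×ˢ Ωy) f r s α

/-- The orthogonal greedy algorithm: each `(r n, s n)` is a minimizer over
`H¹₀(Ωx) × H¹₀(Ωy)` of the energy of step `n`. -/
structure IsOGA (Ωx Ωy : Set ℝ) (f : ℝ × ℝ → ℝ) (r s : ℕ → ℝ → ℝ) (α : ℕ → ℕ → ℝ) : Prop where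
  mem_r : ∀ n, MemH10 Ωx (r n)
  mem_s : ∀ n, MemH10 Ωy (s n)
  minimizer : ∀ n, ∀ p q : ℝ → ℝ, MemH10 Ωx p → MemH10 Ωy q →
    stepEnergy (Ωx ×ˢ Ωy) f r s α n ≤
      energy (Ωx ×ˢ Ωy) (stepResidual (Ωx ×ˢ Ωy) f r s α n) (tensor p q)
  galerkin : IsGalerkin (Ωx ×ˢ Ωy) f r s α

end GreedyPoisson

end

/-! The map `grad` sends H¹₀(Ω) linearly into L²(Ω)² and turns the Dirichlet form into the inner
product, so the theorem becomes a statement about a Hilbert space. Write G for the gradient of g,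
t_n for that of r_n ⊗ s_n, D for the cone `gradTensors`, and R_n for G minus the Galerkin
combination of t_0, …, t_{n-1}. By the weak form of the equation, the residual functional is the
inner product with R_n.

The Euler–Lagrange equations give ⟨R_n, t_n⟩ = ‖t_n‖², so the energy of step n is -‖t_n‖²/2. Since
the Galerkin step does at least as well as adding t_n with coefficient 1, ‖R_{n+1}‖² ≤ ‖R_n - t_n‖²
= ‖R_n‖² - ‖t_n‖². Summing gives ∑ ‖t_n‖² ≤ ‖G‖² (`sum_norm_sq_le_of_galerkin`), hence (i).

If t_n is a minimizer over D, then |⟨R_n, d⟩| ≤ ‖t_n‖ ‖d‖ on D (`abs_inner_le_of_minimizer`), so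
⟨R_n, d⟩ → 0 on span D. Galerkin orthogonality gives ‖R_n‖² = ⟨R_n, G⟩. As R_n is bounded and G lies
in the closure of span D (`grad_mem_closure_span`), this tends to 0, hence (ii).

The density rests on `exists_testTensors_near`: approximate ∂_y ∂_x φ uniformly by
Stone–Weierstrass, integrate in both variables, and cut off by a tensor product. -/

namespace GreedyPoisson

/-! ### Weak derivatives and the vector space structure of H¹₀. -/

section Sobolev

variable {E : Type*} [NormedAddCommGroup E] [NormedSpace ℝ E]

theorem IsTestFunction.add {Ω : Set E} {φ ψ : E → ℝ} (hφ : IsTestFunction Ω φ)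
    (hψ : IsTestFunction Ω ψ) : IsTestFunction Ω (φ + ψ) :=
  ⟨hφ.1.add hψ.1, hφ.2.1.add hψ.2.1,
    (tsupport_add φ ψ).trans (Set.union_subset hφ.2.2 hψ.2.2)⟩

theorem IsTestFunction.const_smul {Ω : Set E} {φ : E → ℝ} (hφ : IsTestFunction Ω φ) (c : ℝ) :
    IsTestFunction Ω (c • φ) :=
  ⟨hφ.1.const_smul c, hφ.2.1.smul_left (f := fun _ => c),
    (tsupport_smul_subset_right (fun _ => c) φ).trans hφ.2.2⟩

theorem isTestFunction_zero (Ω : Set E) : IsTestFunction Ω (0 : E → ℝ) :=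
  ⟨contDiff_const, HasCompactSupport.zero, by simp [tsupport]⟩

theorem IsTestFunction.continuous_fderiv_apply {Ω : Set E} {φ : E → ℝ}
    (hφ : IsTestFunction Ω φ) (v : E) : Continuous fun z => fderiv ℝ φ z v :=
  (hφ.1.continuous_fderiv (by simp)).clm_apply continuous_const

theorem IsTestFunction.differentiable {Ω : Set E} {φ : E → ℝ}
    (hφ : IsTestFunction Ω φ) : Differentiable ℝ φ :=
  hφ.1.differentiable (by simp)

theorem IsTestFunction.eq_zero {Ω : Set E} {φ : E → ℝ}
    (hφ : IsTestFunction Ω φ) {z : E} (hz : z ∉ Ω) : φ z = 0 :=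
  image_eq_zero_of_notMem_tsupport fun h => hz (hφ.2.2 h)

variable [MeasureSpace E]

theorem memLp_weakDeriv (Ω : Set E) (v : E) (u : E → ℝ) :
    MemLp (weakDeriv Ω v u) 2 (volume.restrict Ω) := by
  unfold weakDeriv
  split_ifs with h
  · exact h.choose_spec.1
  · exact MemLp.zero

variable [BorelSpace E]

section Finite

variable [IsFiniteMeasureOnCompacts (volume : Measure E)]

theorem IsTestFunction.memLp {Ω : Set E} {φ : E → ℝ} (hφ : IsTestFunction Ω φ) :
    MemLp φ 2 (volume.restrict Ω) :=
  (hφ.1.continuous.memLp_of_hasCompactSupport hφ.2.1).restrict Ω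

theorem IsTestFunction.memLp_fderiv {Ω : Set E} {φ : E → ℝ} (hφ : IsTestFunction Ω φ) (v : E) :
    MemLp (fun z => fderiv ℝ φ z v) 2 (volume.restrict Ω) :=
  ((hφ.continuous_fderiv_apply v).memLp_of_hasCompactSupport
    (hφ.2.1.fderiv_apply (𝕜 := ℝ) v)).restrict Ω

variable [FiniteDimensional ℝ E]

theorem IsWeakDeriv.ae_eq {Ω : Set E} (hΩ : IsOpen Ω) {v : E} {u w w' : E → ℝ}
    (h : IsWeakDeriv Ω v u w) (h' : IsWeakDeriv Ω v u w')
    (hw : MemLp w 2 (volume.restrict Ω)) (hw' : MemLp w' 2 (volume.restrict Ω)) :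
    w =ᵐ[volume.restrict Ω] w' := by
  have key := hΩ.ae_eq_zero_of_integral_contDiff_smul_eq_zero (μ := volume)
    (f := fun z => w z - w' z)
    (by
      have hloc : LocallyIntegrable (fun z => w z - w' z) (volume.restrict Ω) :=
        (hw.sub hw').locallyIntegrable (by norm_num)
      exact fun x hx => (locallyIntegrableOn_of_locallyIntegrable_restrict hloc) x hx)
    (by
      intro φ h1 h2 h3
      have hφ : IsTestFunction Ω φ := ⟨h1, h2, h3⟩
      rw [← setIntegral_eq_integral_of_forall_compl_eq_zero (s := Ω)
        (fun x hx => by simp [hφ.eq_zero hx])]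
      have e := (h φ hφ).symm.trans (h' φ hφ)
      have i1 : Integrable (fun z => w z * φ z) (volume.restrict Ω) := hw.integrable_mul hφ.memLp
      have i2 : Integrable (fun z => w' z * φ z) (volume.restrict Ω) :=
        hw'.integrable_mul hφ.memLp
      calc ∫ z in Ω, φ z • (w z - w' z) = ∫ z in Ω, (w z * φ z - w' z * φ z) := by
            congr 1; ext z; simp only [smul_eq_mul]; ring
        _ = 0 := by rw [integral_sub i1 i2]; linarith)
  filter_upwards [ae_restrict_of_ae key, ae_restrict_mem hΩ.measurableSet] with z hz hzΩ
  exact sub_eq_zero.1 (hz hzΩ)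

/-- Frees later arguments from the choice made in `weakDeriv`: any concrete L² weak derivative may
replace it almost everywhere. -/
theorem weakDeriv_ae_eq {Ω : Set E} (hΩ : IsOpen Ω) {v : E} {u w : E → ℝ}
    (hw : MemLp w 2 (volume.restrict Ω)) (h : IsWeakDeriv Ω v u w) :
    weakDeriv Ω v u =ᵐ[volume.restrict Ω] w := by
  have hex : ∃ w : E → ℝ, MemLp w 2 (volume.restrict Ω) ∧ IsWeakDeriv Ω v u w := ⟨w, hw, h⟩
  refine IsWeakDeriv.ae_eq hΩ ?_ h (memLp_weakDeriv Ω v u) hw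
  unfold weakDeriv
  rw [dif_pos hex]
  exact hex.choose_spec.2

end Finite

theorem tendsto_integral_mul_of_tendsto_eLpNorm {α : Type*} [MeasurableSpace α] {μ : Measure α}
    {f : ℕ → α → ℝ} {u χ : α → ℝ} (hf : ∀ n, MemLp (f n) 2 μ) (hu : MemLp u 2 μ)
    (hχ : MemLp χ 2 μ)
    (h : Tendsto (fun n => eLpNorm (fun z => f n z - u z) 2 μ) atTop (𝓝 0)) :
    Tendsto (fun n => ∫ z, f n z * χ z ∂μ) atTop (𝓝 (∫ z, u z * χ z ∂μ)) := by
  have h1 := (Lp.tendsto_Lp_iff_tendsto_eLpNorm'' f hf u hu).2 h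
  have h2 := h1.inner (𝕜 := ℝ) (tendsto_const_nhds (x := hχ.toLp χ))
  have e : ∀ {p : α → ℝ} (hp : MemLp p 2 μ),
      inner ℝ (hp.toLp p) (hχ.toLp χ) = ∫ z, p z * χ z ∂μ := by
    intro p hp
    rw [L2.inner_def]
    refine integral_congr_ae ?_
    filter_upwards [hp.coeFn_toLp, hχ.coeFn_toLp] with z h1 h2
    simp [h1, h2, mul_comm]
  simpa only [e] using h2

variable [FiniteDimensional ℝ E] [(volume : Measure E).IsAddHaarMeasure]

theorem IsTestFunction.isWeakDeriv {Ω : Set E} {φ : E → ℝ} (hφ : IsTestFunction Ω φ) (v : E) :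
    IsWeakDeriv Ω v φ fun z => fderiv ℝ φ z v := by
  intro ψ hψ
  rw [setIntegral_eq_integral_of_forall_compl_eq_zero (fun x hx => by simp [hφ.eq_zero hx]),
    setIntegral_eq_integral_of_forall_compl_eq_zero (fun x hx => by simp [hψ.eq_zero hx])]
  refine integral_mul_fderiv_eq_neg_fderiv_mul_of_integrable ?_ ?_ ?_
    (fun x _ => hφ.differentiable x) (fun x _ => hψ.differentiable x)
  · exact ((hφ.continuous_fderiv_apply v).mul hψ.1.continuous).integrable_of_hasCompactSupport
      hψ.2.1.mul_left
  · exact (hφ.1.continuous.mul (hψ.continuous_fderiv_apply v)).integrable_of_hasCompactSupport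
      hφ.2.1.mul_right
  · exact (hφ.1.continuous.mul hψ.1.continuous).integrable_of_hasCompactSupport hφ.2.1.mul_right

/-- The weak derivative is closed. -/
theorem isWeakDeriv_of_tendsto {Ω : Set E} {v : E} {u w : E → ℝ} {φ : ℕ → E → ℝ}
    (hφ : ∀ k, IsTestFunction Ω (φ k))
    (hu : MemLp u 2 (volume.restrict Ω)) (hw : MemLp w 2 (volume.restrict Ω))
    (h0 : Tendsto (fun k => eLpNorm (fun z => φ k z - u z) 2 (volume.restrict Ω)) atTop (𝓝 0))
    (h1 : Tendsto (fun k => eLpNorm (fun z => fderiv ℝ (φ k) z v - w z) 2 (volume.restrict Ω))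
      atTop (𝓝 0)) :
    IsWeakDeriv Ω v u w := by
  intro ψ hψ
  have t1 := tendsto_integral_mul_of_tendsto_eLpNorm (fun k => (hφ k).memLp) hu
    (hψ.memLp_fderiv v) h0
  have t2 := tendsto_integral_mul_of_tendsto_eLpNorm (fun k => (hφ k).memLp_fderiv v) hw
    hψ.memLp h1
  refine tendsto_nhds_unique t1 ?_
  simpa only [(hφ _).isWeakDeriv v ψ hψ] using t2.neg

/-- The L² limits of the derivatives are the weak derivatives of the limit, by closedness.
Membership and derivatives of sums, multiples and tensor products all come from this lemma. -/
theorem memH10_of_tendsto {Ω : Set E} (hΩ : IsOpen Ω) {u : E → ℝ} {w : E → E → ℝ}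
    {φ : ℕ → E → ℝ} (hφ : ∀ k, IsTestFunction Ω (φ k))
    (hu : MemLp u 2 (volume.restrict Ω)) (hw : ∀ v, MemLp (w v) 2 (volume.restrict Ω))
    (h0 : Tendsto (fun k => eLpNorm (fun z => φ k z - u z) 2 (volume.restrict Ω)) atTop (𝓝 0))
    (h1 : ∀ v, Tendsto
      (fun k => eLpNorm (fun z => fderiv ℝ (φ k) z v - w v z) 2 (volume.restrict Ω))
      atTop (𝓝 0)) :
    MemH10 Ω u ∧ ∀ v, weakDeriv Ω v u =ᵐ[volume.restrict Ω] w v := by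
  have hd : ∀ v, IsWeakDeriv Ω v u (w v) := fun v =>
    isWeakDeriv_of_tendsto hφ hu (hw v) h0 (h1 v)
  have hae : ∀ v, weakDeriv Ω v u =ᵐ[volume.restrict Ω] w v := fun v =>
    weakDeriv_ae_eq hΩ (hw v) (hd v)
  refine ⟨⟨⟨hu, fun v => ⟨w v, hw v, hd v⟩⟩, φ, hφ, h0, fun v => ?_⟩, hae⟩
  refine (h1 v).congr fun k => eLpNorm_congr_ae ?_
  filter_upwards [hae v] with z hz
  rw [hz]

theorem IsTestFunction.memH10 {Ω : Set E} (hΩ : IsOpen Ω) {φ : E → ℝ}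
    (hφ : IsTestFunction Ω φ) :
    MemH10 Ω φ ∧ ∀ v, weakDeriv Ω v φ =ᵐ[volume.restrict Ω] fun z => fderiv ℝ φ z v := by
  refine memH10_of_tendsto hΩ (fun _ => hφ) hφ.memLp (fun v => hφ.memLp_fderiv v) ?_ ?_ <;>
  simp

theorem tendsto_eLpNorm_of_le {α : Type*} [MeasurableSpace α] {μ : Measure α}
    {f : ℕ → α → ℝ} {b : ℕ → ℝ≥0∞} (hb : Tendsto b atTop (𝓝 0))
    (h : ∀ k, eLpNorm (f k) 2 μ ≤ b k) :
    Tendsto (fun k => eLpNorm (f k) 2 μ) atTop (𝓝 0) :=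
  tendsto_of_tendsto_of_tendsto_of_le_of_le tendsto_const_nhds hb (fun _ => zero_le) h

theorem MemH10.add {Ω : Set E} (hΩ : IsOpen Ω) {u u' : E → ℝ} (hu : MemH10 Ω u)
    (hu' : MemH10 Ω u') :
    MemH10 Ω (u + u') ∧ ∀ v, weakDeriv Ω v (u + u') =ᵐ[volume.restrict Ω]
      weakDeriv Ω v u + weakDeriv Ω v u' := by
  obtain ⟨hu1, φ, hφ, h0, h1⟩ := hu
  obtain ⟨hu1', φ', hφ', h0', h1'⟩ := hu'
  refine memH10_of_tendsto hΩ (φ := fun k => φ k + φ' k) (fun k => (hφ k).add (hφ' k))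
    (hu1.1.add hu1'.1) (fun v => (memLp_weakDeriv Ω v u).add (memLp_weakDeriv Ω v u')) ?_ ?_
  · refine tendsto_eLpNorm_of_le (by simpa using h0.add h0') fun k => ?_
    refine le_trans (le_of_eq ?_) (eLpNorm_add_le ((hφ k).memLp.sub hu1.1).1
      ((hφ' k).memLp.sub hu1'.1).1 (by norm_num))
    congr 1
    ext z
    simp only [Pi.add_apply]
    ring
  · intro v
    refine tendsto_eLpNorm_of_le (by simpa using (h1 v).add (h1' v)) fun k => ?_
    refine le_trans (le_of_eq ?_) (eLpNorm_add_le
      (((hφ k).memLp_fderiv v).sub (memLp_weakDeriv Ω v u)).1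
      (((hφ' k).memLp_fderiv v).sub (memLp_weakDeriv Ω v u')).1 (by norm_num))
    congr 1
    ext z
    rw [fderiv_add ((hφ k).differentiable z) ((hφ' k).differentiable z)]
    simp only [Pi.add_apply, add_apply]
    ring

theorem MemH10.const_smul {Ω : Set E} (hΩ : IsOpen Ω) {u : E → ℝ} (hu : MemH10 Ω u) (c : ℝ) :
    MemH10 Ω (c • u) ∧ ∀ v, weakDeriv Ω v (c • u) =ᵐ[volume.restrict Ω]
      c • weakDeriv Ω v u := by
  obtain ⟨hu1, φ, hφ, h0, h1⟩ := hu
  refine memH10_of_tendsto hΩ (φ := fun k => c • φ k) (fun k => (hφ k).const_smul c)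
    (hu1.1.const_smul c) (fun v => (memLp_weakDeriv Ω v u).const_smul c) ?_ ?_
  · have := ENNReal.Tendsto.const_mul (a := ‖c‖ₑ) h0 (Or.inr (by simp))
    rw [mul_zero] at this
    refine this.congr fun k => ?_
    rw [← eLpNorm_const_smul]
    congr 1
    ext z
    simp only [Pi.smul_apply, smul_eq_mul]
    ring
  · intro v
    have := ENNReal.Tendsto.const_mul (a := ‖c‖ₑ) (h1 v) (Or.inr (by simp))
    rw [mul_zero] at this
    refine this.congr fun k => ?_
    rw [← eLpNorm_const_smul]
    congr 1
    ext z
    rw [fderiv_const_smul ((hφ k).differentiable z)]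
    simp only [Pi.smul_apply, smul_eq_mul, smul_apply]
    ring

end Sobolev

/-! ### Tensor products of one-variable H¹₀ functions. -/

section Tensor

theorem eLpNorm_two_sq {X : Type*} [MeasurableSpace X] {μ : Measure X} (p : X → ℝ) :
    eLpNorm p 2 μ ^ 2 = ∫⁻ z, ‖p z‖ₑ ^ 2 ∂μ := by
  rw [eLpNorm_eq_lintegral_rpow_enorm_toReal two_ne_zero ENNReal.ofNat_ne_top]
  simp only [ENNReal.toReal_ofNat, ENNReal.rpow_two]
  rw [← ENNReal.rpow_natCast, ← ENNReal.rpow_mul]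
  norm_num

/-- Tonelli for the squares, then injectivity of squaring on `ℝ≥0∞`. -/
theorem eLpNorm_tensor {μ ν : Measure ℝ} [SFinite ν] {r s : ℝ → ℝ}
    (hr : AEStronglyMeasurable r μ) (hs : AEStronglyMeasurable s ν) :
    eLpNorm (tensor r s) 2 (μ.prod ν) = eLpNorm r 2 μ * eLpNorm s 2 ν := by
  have h : eLpNorm (tensor r s) 2 (μ.prod ν) ^ 2 = (eLpNorm r 2 μ * eLpNorm s 2 ν) ^ 2 := by
    rw [mul_pow]
    simp only [eLpNorm_two_sq]
    rw [← lintegral_prod_mul (hr.enorm.pow_const 2) (hs.enorm.pow_const 2)]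
    simp only [tensor, enorm_mul, mul_pow]
  exact (ENNReal.pow_right_strictMono two_ne_zero).injective h

theorem memLp_tensor {μ ν : Measure ℝ} [SFinite μ] [SFinite ν] {r s : ℝ → ℝ}
    (hr : MemLp r 2 μ) (hs : MemLp s 2 ν) : MemLp (tensor r s) 2 (μ.prod ν) := by
  refine ⟨(hr.1.comp_fst (ν := ν)).mul (hs.1.comp_snd (μ := μ)), ?_⟩
  rw [eLpNorm_tensor hr.1 hs.1]
  exact ENNReal.mul_lt_top hr.2 hs.2

theorem tendsto_eLpNorm_tensor_sub {μ ν : Measure ℝ} [SFinite μ] [SFinite ν] {r s : ℝ → ℝ}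
    {p q : ℕ → ℝ → ℝ} (hp : ∀ k, MemLp (p k) 2 μ) (hq : ∀ k, MemLp (q k) 2 ν)
    (hr : MemLp r 2 μ) (hs : MemLp s 2 ν)
    (h0 : Tendsto (fun k => eLpNorm (fun z => p k z - r z) 2 μ) atTop (𝓝 0))
    (h1 : Tendsto (fun k => eLpNorm (fun z => q k z - s z) 2 ν) atTop (𝓝 0)) :
    Tendsto (fun k => eLpNorm (fun z => tensor (p k) (q k) z - tensor r s z) 2 (μ.prod ν))
      atTop (𝓝 0) := by
  have hb : Tendsto (fun k => eLpNorm (p k - r) 2 μ * eLpNorm (q k - s) 2 ν +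
      (eLpNorm (p k - r) 2 μ * eLpNorm s 2 ν + eLpNorm r 2 μ * eLpNorm (q k - s) 2 ν))
      atTop (𝓝 0) := by
    have t1 := ENNReal.Tendsto.mul h0 (Or.inr ENNReal.zero_ne_top) h1 (Or.inr ENNReal.zero_ne_top)
    have t2 := ENNReal.Tendsto.mul_const (b := eLpNorm s 2 ν) h0 (Or.inr hs.2.ne)
    have t3 := ENNReal.Tendsto.const_mul (a := eLpNorm r 2 μ) h1 (Or.inr hr.2.ne)
    have t := t1.add (t2.add t3)
    simp only [mul_zero, zero_mul, add_zero] at t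
    exact t
  refine tendsto_eLpNorm_of_le hb fun k => ?_
  have hpr := (hp k).sub hr
  have hqs := (hq k).sub hs
  rw [← eLpNorm_tensor hpr.1 hqs.1, ← eLpNorm_tensor hpr.1 hs.1, ← eLpNorm_tensor hr.1 hqs.1]
  have e : (fun z => tensor (p k) (q k) z - tensor r s z) =
      tensor (p k - r) (q k - s) + (tensor (p k - r) s + tensor r (q k - s)) := by
    ext z
    simp only [tensor, Pi.add_apply, Pi.sub_apply]
    ring
  rw [e]
  have m1 := memLp_tensor hpr hs
  have m2 := memLp_tensor hr hqs
  exact (eLpNorm_add_le (memLp_tensor hpr hqs).1 (m1.add m2).1 (by norm_num)).trans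
    (by gcongr; exact eLpNorm_add_le m1.1 m2.1 (by norm_num))

theorem volume_restrict_prod (Ωx Ωy : Set ℝ) :
    (volume : Measure (ℝ × ℝ)).restrict (Ωx ×ˢ Ωy) =
      (volume.restrict Ωx).prod (volume.restrict Ωy) := by
  rw [Measure.prod_restrict, Measure.volume_eq_prod]

theorem hasFDerivAt_tensor {p q : ℝ → ℝ} (hp : Differentiable ℝ p) (hq : Differentiable ℝ q)
    (z : ℝ × ℝ) :
    HasFDerivAt (tensor p q) (p z.1 • (deriv q z.2 • ContinuousLinearMap.snd ℝ ℝ ℝ) +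
      q z.2 • (deriv p z.1 • ContinuousLinearMap.fst ℝ ℝ ℝ)) z := by
  have h1 : HasFDerivAt (fun z : ℝ × ℝ => p z.1) (deriv p z.1 • ContinuousLinearMap.fst ℝ ℝ ℝ) z :=
    (hp z.1).hasDerivAt.comp_hasFDerivAt z hasFDerivAt_fst
  have h2 : HasFDerivAt (fun z : ℝ × ℝ => q z.2) (deriv q z.2 • ContinuousLinearMap.snd ℝ ℝ ℝ) z :=
    (hq z.2).hasDerivAt.comp_hasFDerivAt z hasFDerivAt_snd
  exact h1.mul h2

theorem fderiv_tensor_apply {p q : ℝ → ℝ} (hp : Differentiable ℝ p) (hq : Differentiable ℝ q)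
    (z v : ℝ × ℝ) :
    fderiv ℝ (tensor p q) z v =
      v.1 * tensor (deriv p) q z + v.2 * tensor p (deriv q) z := by
  rw [(hasFDerivAt_tensor hp hq z).fderiv]
  simp [tensor]
  ring

theorem contDiff_tensor {p q : ℝ → ℝ} {n : ℕ∞ω} (hp : ContDiff ℝ n p) (hq : ContDiff ℝ n q) :
    ContDiff ℝ n (tensor p q) :=
  (hp.comp contDiff_fst).mul (hq.comp contDiff_snd)

theorem isTestFunction_of_support_subset {E : Type*} [NormedAddCommGroup E] [NormedSpace ℝ E]
    {Ω K : Set E} {φ : E → ℝ} (hφ : ContDiff ℝ ∞ φ) (hK : IsCompact K) (hKΩ : K ⊆ Ω)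
    (h : Function.support φ ⊆ K) : IsTestFunction Ω φ := by
  have hK' : tsupport φ ⊆ K := closure_minimal h hK.isClosed
  exact ⟨hφ, hK.of_isClosed_subset (isClosed_tsupport φ) hK', hK'.trans hKΩ⟩

theorem IsTestFunction.tensor {Ωx Ωy : Set ℝ} {p q : ℝ → ℝ} (hp : IsTestFunction Ωx p)
    (hq : IsTestFunction Ωy q) : IsTestFunction (Ωx ×ˢ Ωy) (tensor p q) := by
  refine isTestFunction_of_support_subset (contDiff_tensor hp.1 hq.1) (hp.2.1.prod hq.2.1)
    (Set.prod_mono hp.2.2 hq.2.2) fun z hz => ?_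
  have hz' : p z.1 * q z.2 ≠ 0 := hz
  exact ⟨subset_tsupport p (left_ne_zero_of_mul hz'), subset_tsupport q (right_ne_zero_of_mul hz')⟩

/-- The first derivatives of r ⊗ s are r' ⊗ s and r ⊗ s', products of one-variable L² functions, so
tensor products of the approximating test functions converge in H¹. -/
theorem MemH10.tensor {Ωx Ωy : Set ℝ} (hΩx : IsOpen Ωx) (hΩy : IsOpen Ωy) {r s : ℝ → ℝ}
    (hr : MemH10 Ωx r) (hs : MemH10 Ωy s) : MemH10 (Ωx ×ˢ Ωy) (tensor r s) := by
  obtain ⟨hr1, p, hp, hp0, hp1⟩ := hr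
  obtain ⟨hs1, q, hq, hq0, hq1⟩ := hs
  have mr := memLp_weakDeriv Ωx 1 r
  have ms := memLp_weakDeriv Ωy 1 s
  -- `deriv` is by definition `fderiv` applied to the direction 1.
  have hd1 : ∀ k, MemLp (deriv (p k)) 2 (volume.restrict Ωx) := fun k => (hp k).memLp_fderiv 1
  have hd2 : ∀ k, MemLp (deriv (q k)) 2 (volume.restrict Ωy) := fun k => (hq k).memLp_fderiv 1
  have mx := memLp_tensor mr hs1.1
  have my := memLp_tensor hr1.1 ms
  have tx := tendsto_eLpNorm_tensor_sub hd1 (fun k => (hq k).memLp) mr hs1.1 (hp1 1) hq0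
  have ty := tendsto_eLpNorm_tensor_sub (fun k => (hp k).memLp) hd2 hr1.1 ms hp0 (hq1 1)
  refine (memH10_of_tendsto (hΩx.prod hΩy) (φ := fun k => GreedyPoisson.tensor (p k) (q k))
    (w := fun v => v.1 • GreedyPoisson.tensor (weakDeriv Ωx 1 r) s +
      v.2 • GreedyPoisson.tensor r (weakDeriv Ωy 1 s))
    (fun k => (hp k).tensor (hq k)) ?_ (fun v => ?_) ?_ fun v => ?_).1
  · rw [volume_restrict_prod]
    exact memLp_tensor hr1.1 hs1.1
  · rw [volume_restrict_prod]
    exact (mx.const_smul v.1).add (my.const_smul v.2)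
  · rw [volume_restrict_prod]
    exact tendsto_eLpNorm_tensor_sub (fun k => (hp k).memLp) (fun k => (hq k).memLp) hr1.1 hs1.1
      hp0 hq0
  · rw [volume_restrict_prod]
    have hb := (ENNReal.Tendsto.const_mul (a := ‖v.1‖ₑ) tx (Or.inr (by simp))).add
      (ENNReal.Tendsto.const_mul (a := ‖v.2‖ₑ) ty (Or.inr (by simp)))
    refine tendsto_eLpNorm_of_le (by simpa using hb) fun k => ?_
    rw [← eLpNorm_const_smul, ← eLpNorm_const_smul]
    refine le_trans (le_of_eq ?_) (eLpNorm_add_le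
      (((memLp_tensor (hd1 k) (hq k).memLp).sub mx).const_smul v.1).1
      (((memLp_tensor (hp k).memLp (hd2 k)).sub my).const_smul v.2).1 (by norm_num))
    congr 1
    ext z
    rw [fderiv_tensor_apply (hp k).differentiable (hq k).differentiable]
    simp only [Pi.add_apply, Pi.smul_apply, smul_eq_mul]
    ring

end Tensor

/-! ### Density of tensor products of test functions. -/

section Density

theorem exists_isTestFunction_eq_one {E : Type*} [NormedAddCommGroup E] [NormedSpace ℝ E]
    [FiniteDimensional ℝ E] {Ω K : Set E} (hΩ : IsOpen Ω) (hK : IsCompact K) (hKΩ : K ⊆ Ω) :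
    ∃ χ : E → ℝ, IsTestFunction Ω χ ∧ ∀ x ∈ K, χ x = 1 := by
  have : ProperSpace E := FiniteDimensional.proper ℝ E
  obtain ⟨δ, hδ, hδΩ⟩ := hK.exists_cthickening_subset_open hΩ hKΩ
  obtain ⟨χ, hχ, -, hsupp, h1⟩ := exists_contMDiff_support_eq_eq_one_iff (modelWithCornersSelf ℝ E)
    (n := ⊤) Metric.isOpen_thickening hK.isClosed (Metric.self_subset_thickening hδ K)
  refine ⟨χ, isTestFunction_of_support_subset hχ.contDiff hK.cthickening hδΩ ?_,
    fun x hx => (h1 x).1 hx⟩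
  rw [hsupp]
  exact Metric.thickening_subset_cthickening δ K

theorem exists_contDiff_antideriv {a : ℝ → ℝ} (ha : ContDiff ℝ ∞ a) (c : ℝ) :
    ∃ A : ℝ → ℝ, ContDiff ℝ ∞ A ∧ deriv A = a ∧ A c = 0 := by
  have hd : ∀ x, HasDerivAt (fun x => ∫ t in c..x, a t) (a x) x := fun x =>
    ha.continuous.integral_hasStrictDerivAt c x |>.hasDerivAt
  have he : deriv (fun x => ∫ t in c..x, a t) = a := funext fun x => (hd x).deriv
  refine ⟨fun x => ∫ t in c..x, a t, ?_, he, by simp⟩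
  rw [contDiff_infty_iff_deriv, he]
  exact ⟨fun x => (hd x).differentiableAt, ha⟩

/-- Finite sums of tensor products of smooth functions. -/
def smoothTensors : Submodule ℝ (ℝ × ℝ → ℝ) :=
  Submodule.span ℝ {u | ∃ a b : ℝ → ℝ, ContDiff ℝ ∞ a ∧ ContDiff ℝ ∞ b ∧ u = tensor a b}

/-- Finite sums of tensor products of test functions. -/
def testTensors (Ωx Ωy : Set ℝ) : Submodule ℝ (ℝ × ℝ → ℝ) :=
  Submodule.span ℝ {u | ∃ p q : ℝ → ℝ, IsTestFunction Ωx p ∧ IsTestFunction Ωy q ∧ u = tensor p q}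

theorem tensor_mem_smoothTensors {a b : ℝ → ℝ} (ha : ContDiff ℝ ∞ a) (hb : ContDiff ℝ ∞ b) :
    tensor a b ∈ smoothTensors :=
  Submodule.subset_span ⟨a, b, ha, hb, rfl⟩

theorem mul_mem_smoothTensors {u v : ℝ × ℝ → ℝ} (hu : u ∈ smoothTensors)
    (hv : v ∈ smoothTensors) : u * v ∈ smoothTensors := by
  unfold smoothTensors at hu hv
  induction hu, hv using Submodule.span_induction₂ with
  | mem_mem x y hx hy =>
    obtain ⟨a, b, ha, hb, rfl⟩ := hx
    obtain ⟨a', b', ha', hb', rfl⟩ := hy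
    have : tensor a b * tensor a' b' = tensor (a * a') (b * b') := by
      ext z
      simp only [tensor, Pi.mul_apply]
      ring
    rw [this]
    exact tensor_mem_smoothTensors (ha.mul ha') (hb.mul hb')
  | zero_left y hy => simp
  | zero_right y hy => simp
  | add_left x y z _ _ _ h1 h2 => rw [add_mul]; exact smoothTensors.add_mem h1 h2
  | add_right x y z _ _ _ h1 h2 => rw [mul_add]; exact smoothTensors.add_mem h1 h2
  | smul_left r x y _ _ h => rw [smul_mul_assoc]; exact smoothTensors.smul_mem r h
  | smul_right r x y _ _ h => rw [mul_smul_comm]; exact smoothTensors.smul_mem r h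

/-- Stone–Weierstrass: restricted to X, these sums form a subalgebra, and the coordinates separate
points. -/
theorem exists_smoothTensors_near {X : Set (ℝ × ℝ)} (hX : IsCompact X) {ψ : ℝ × ℝ → ℝ}
    (hψ : Continuous ψ) {ε : ℝ} (hε : 0 < ε) :
    ∃ S ∈ smoothTensors, ∀ z ∈ X, |S z - ψ z| ≤ ε := by
  have : CompactSpace X := isCompact_iff_compactSpace.1 hX
  let A : Subalgebra ℝ C(X, ℝ) :=
    { carrier := {F | ∃ S ∈ smoothTensors, ∀ z : X, F z = S z}
      mul_mem' := by
        rintro F F' ⟨S, hS, h⟩ ⟨S', hS', h'⟩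
        exact ⟨S * S', mul_mem_smoothTensors hS hS', fun z => by simp [h, h']⟩
      add_mem' := by
        rintro F F' ⟨S, hS, h⟩ ⟨S', hS', h'⟩
        exact ⟨S + S', smoothTensors.add_mem hS hS', fun z => by simp [h, h']⟩
      algebraMap_mem' := fun c =>
        ⟨tensor (fun _ => c) (fun _ => 1),
          tensor_mem_smoothTensors contDiff_const contDiff_const, fun z => by simp [tensor]⟩ }
  have hA : A.SeparatesPoints := by
    intro z w hzw
    have hzw' : (z : ℝ × ℝ) ≠ w := fun h => hzw (Subtype.ext h)
    rw [Ne, Prod.ext_iff, not_and_or] at hzw'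
    rcases hzw' with h | h
    · refine ⟨_, ⟨⟨fun z : X => z.1.1, by fun_prop⟩, ⟨tensor (fun x => x) (fun _ => 1),
        tensor_mem_smoothTensors contDiff_id contDiff_const, fun z => by simp [tensor]⟩, rfl⟩, h⟩
    · refine ⟨_, ⟨⟨fun z : X => z.1.2, by fun_prop⟩, ⟨tensor (fun _ => 1) (fun x => x),
        tensor_mem_smoothTensors contDiff_const contDiff_id, fun z => by simp [tensor]⟩, rfl⟩, h⟩
  obtain ⟨⟨F, S, hS, hFS⟩, hF⟩ :=
    ContinuousMap.exists_mem_subalgebra_near_continuous_of_separatesPoints A hA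
    (fun z : X => ψ z) (by fun_prop) ε hε
  refine ⟨S, hS, fun z hz => ?_⟩
  have := hF ⟨z, hz⟩
  rw [← hFS ⟨z, hz⟩]
  exact le_of_lt this

theorem contDiff_fderiv_apply {E : Type*} [NormedAddCommGroup E] [NormedSpace ℝ E] {u : E → ℝ}
    (hu : ContDiff ℝ ∞ u) (v : E) : ContDiff ℝ ∞ fun z => fderiv ℝ u z v :=
  (hu.fderiv_right (m := ∞) (by simp)).clm_apply contDiff_const

/-- `∂_y ∂_x u`. -/
noncomputable def mixedDeriv (u : ℝ × ℝ → ℝ) (z : ℝ × ℝ) : ℝ :=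
  fderiv ℝ (fun w => fderiv ℝ u w (1, 0)) z (0, 1)

theorem mixedDeriv_add {u v : ℝ × ℝ → ℝ} (hu : ContDiff ℝ ∞ u) (hv : ContDiff ℝ ∞ v) :
    mixedDeriv (u + v) = mixedDeriv u + mixedDeriv v := by
  ext z
  have h : (fun w => fderiv ℝ (u + v) w (1, 0)) =
      (fun w => fderiv ℝ u w (1, 0)) + fun w => fderiv ℝ v w (1, 0) := by
    ext w
    rw [fderiv_add (hu.differentiable (by simp) w) (hv.differentiable (by simp) w)]
    rfl
  rw [mixedDeriv, h, fderiv_add ((contDiff_fderiv_apply hu _).differentiable (by simp) z)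
    ((contDiff_fderiv_apply hv _).differentiable (by simp) z)]
  rfl

theorem mixedDeriv_const_smul {u : ℝ × ℝ → ℝ} (hu : ContDiff ℝ ∞ u) (c : ℝ) :
    mixedDeriv (c • u) = c • mixedDeriv u := by
  ext z
  have h : (fun w => fderiv ℝ (c • u) w (1, 0)) = c • fun w => fderiv ℝ u w (1, 0) := by
    ext w
    rw [fderiv_const_smul (hu.differentiable (by simp) w)]
    rfl
  rw [mixedDeriv, h, fderiv_const_smul ((contDiff_fderiv_apply hu _).differentiable (by simp) z)]
  rfl

theorem mixedDeriv_tensor {A B : ℝ → ℝ} (hA : ContDiff ℝ ∞ A) (hB : ContDiff ℝ ∞ B) :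
    mixedDeriv (tensor A B) = tensor (deriv A) (deriv B) := by
  have hA' := (contDiff_infty_iff_deriv.1 hA)
  have hB' := (contDiff_infty_iff_deriv.1 hB)
  have h : (fun w => fderiv ℝ (tensor A B) w (1, 0)) = tensor (deriv A) B := by
    ext w
    rw [fderiv_tensor_apply hA'.1 hB'.1]
    simp
  ext z
  rw [mixedDeriv, h, fderiv_tensor_apply (hA'.2.differentiable (by simp)) hB'.1]
  simp

theorem mixedDeriv_symm {u : ℝ × ℝ → ℝ} (hu : ContDiff ℝ ∞ u) (z : ℝ × ℝ) :
    mixedDeriv u z = fderiv ℝ (fun w => fderiv ℝ u w (0, 1)) z (1, 0) := by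
  have hd : DifferentiableAt ℝ (fderiv ℝ u) z :=
    (hu.fderiv_right (m := ∞) (by simp)).differentiable (by simp) z
  have h : ∀ v v' : ℝ × ℝ, fderiv ℝ (fun w => fderiv ℝ u w v) z v' =
      fderiv ℝ (fderiv ℝ u) z v' v := by
    intro v v'
    rw [fderiv_clm_apply hd (differentiableAt_const v)]
    simp
  rw [mixedDeriv, h, h]
  exact (hu.contDiffAt.isSymmSndFDerivAt (by simp; exact WithTop.coe_le_coe.2 le_top)).eq _ _

/-- Every finite sum of smooth tensor products is a mixed derivative of a function of the same
kind which vanishes on two coordinate lines. -/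
theorem exists_mixedDeriv_eq {S : ℝ × ℝ → ℝ} (hS : S ∈ smoothTensors) (c : ℝ) :
    ∃ D : ℝ × ℝ → ℝ, ContDiff ℝ ∞ D ∧ mixedDeriv D = S ∧ (∀ y, D (c, y) = 0) ∧
      (∀ x, D (x, c) = 0) ∧ ∀ (Ωx Ωy : Set ℝ) (χ η : ℝ → ℝ), IsTestFunction Ωx χ →
        IsTestFunction Ωy η → tensor χ η * D ∈ testTensors Ωx Ωy := by
  unfold smoothTensors at hS
  induction hS using Submodule.span_induction with
  | mem x hx =>
    obtain ⟨a, b, ha, hb, rfl⟩ := hx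
    -- Primitives based at c: A ⊗ B has mixed derivative a ⊗ b and vanishes on both lines through c.
    obtain ⟨A, hA, rfl, hA0⟩ := exists_contDiff_antideriv ha c
    obtain ⟨B, hB, rfl, hB0⟩ := exists_contDiff_antideriv hb c
    refine ⟨tensor A B, contDiff_tensor hA hB, mixedDeriv_tensor hA hB,
      fun y => by simp [tensor, hA0], fun x => by simp [tensor, hB0], ?_⟩
    intro Ωx Ωy χ η hχ hη
    have hmul : ∀ {Ω : Set ℝ} {χ A : ℝ → ℝ}, IsTestFunction Ω χ → ContDiff ℝ ∞ A →
        IsTestFunction Ω (χ * A) := fun h hA =>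
      isTestFunction_of_support_subset (h.1.mul hA) h.2.1 h.2.2
        ((Function.support_mul_subset_left _ _).trans (subset_tsupport _))
    refine Submodule.subset_span ⟨χ * A, η * B, hmul hχ hA, hmul hη hB, ?_⟩
    ext z
    simp only [tensor, Pi.mul_apply]
    ring
  | zero =>
    refine ⟨0, contDiff_const, ?_, by simp, by simp, fun _ _ _ _ _ _ => by simp⟩
    ext z
    simp [mixedDeriv]
  | add x y _ _ hx hy =>
    obtain ⟨D, h1, h2, h3, h4, h5⟩ := hx
    obtain ⟨D', h1', h2', h3', h4', h5'⟩ := hy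
    refine ⟨D + D', h1.add h1', by rw [mixedDeriv_add h1 h1', h2, h2'], by simp [h3, h3'],
      by simp [h4, h4'], fun _ _ _ _ hχ hη => ?_⟩
    rw [mul_add]
    exact Submodule.add_mem _ (h5 _ _ _ _ hχ hη) (h5' _ _ _ _ hχ hη)
  | smul r x _ hx =>
    obtain ⟨D, h1, h2, h3, h4, h5⟩ := hx
    refine ⟨r • D, h1.const_smul r, by rw [mixedDeriv_const_smul h1, h2], by simp [h3],
      by simp [h4], fun _ _ _ _ hχ hη => ?_⟩
    rw [mul_smul_comm]
    exact Submodule.smul_mem _ _ (h5 _ _ _ _ hχ hη)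

theorem hasDerivAt_slice_fst {u : ℝ × ℝ → ℝ} (hu : Differentiable ℝ u) (x y : ℝ) :
    HasDerivAt (fun t => u (t, y)) (fderiv ℝ u (x, y) (1, 0)) x :=
  (hu (x, y)).hasFDerivAt.comp_hasDerivAt x ((hasDerivAt_id x).prodMk (hasDerivAt_const x y))

theorem hasDerivAt_slice_snd {u : ℝ × ℝ → ℝ} (hu : Differentiable ℝ u) (x y : ℝ) :
    HasDerivAt (fun t => u (x, t)) (fderiv ℝ u (x, y) (0, 1)) y :=
  (hu (x, y)).hasFDerivAt.comp_hasDerivAt y ((hasDerivAt_const y x).prodMk (hasDerivAt_id y))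

/-- Mean value inequality from the left endpoint; 2M is the length of the interval. -/
theorem abs_le_of_hasDerivAt {h h' : ℝ → ℝ} {M C : ℝ} (hM : 0 ≤ M)
    (hd : ∀ x, HasDerivAt h (h' x) x)
    (hb : ∀ x ∈ Set.Icc (-M) M, |h' x| ≤ C) (h0 : h (-M) = 0) {x : ℝ}
    (hx : x ∈ Set.Icc (-M) M) : |h x| ≤ C * (2 * M) := by
  have hmem : -M ∈ Set.Icc (-M) M := ⟨le_rfl, by linarith⟩
  have h1 := (convex_Icc (-M) M).norm_image_sub_le_of_norm_deriv_le (f := h) (C := C)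
    (fun x _ => (hd x).differentiableAt) (fun x hx => by rw [(hd x).deriv]; exact hb x hx)
    hmem hx
  rw [h0, sub_zero, Real.norm_eq_abs, Real.norm_eq_abs] at h1
  have hC : 0 ≤ C := (abs_nonneg _).trans (hb x hx)
  refine h1.trans (mul_le_mul_of_nonneg_left ?_ hC)
  rw [abs_of_nonneg] <;> linarith [hx.1, hx.2]

/-- A function vanishing on two sides of a square is controlled in `C¹` by its mixed
derivative. -/
theorem abs_fderiv_le_of_mixedDeriv_le {D : ℝ × ℝ → ℝ} (hD : ContDiff ℝ ∞ D) {M ε : ℝ}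
    (hM : 0 ≤ M) (hx0 : ∀ y, D (-M, y) = 0) (hy0 : ∀ x, D (x, -M) = 0)
    (hb : ∀ z ∈ Set.Icc (-M) M ×ˢ Set.Icc (-M) M, |mixedDeriv D z| ≤ ε) :
    ∀ z ∈ Set.Icc (-M) M ×ˢ Set.Icc (-M) M, |fderiv ℝ D z (1, 0)| ≤ ε * (2 * M) ∧
      |fderiv ℝ D z (0, 1)| ≤ ε * (2 * M) ∧ |D z| ≤ ε * (2 * M) * (2 * M) := by
  have hd := hD.differentiable (by simp)
  have hd1 := (contDiff_fderiv_apply hD (1, 0)).differentiable (by simp)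
  have hd2 := (contDiff_fderiv_apply hD (0, 1)).differentiable (by simp)
  have h1 : ∀ z ∈ Set.Icc (-M) M ×ˢ Set.Icc (-M) M, |fderiv ℝ D z (1, 0)| ≤ ε * (2 * M) := by
    rintro ⟨x, y⟩ ⟨hx, hy⟩
    -- In y, the function ∂_x D has derivative `mixedDeriv D`, and it starts from 0 because D
    -- vanishes on the side y = -M.
    refine abs_le_of_hasDerivAt hM (fun y => hasDerivAt_slice_snd hd1 x y)
      (fun t ht => hb (x, t) ⟨hx, ht⟩) ?_ hy
    rw [← (hasDerivAt_slice_fst hd x (-M)).deriv]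
    simp [hy0]
  have h2 : ∀ z ∈ Set.Icc (-M) M ×ˢ Set.Icc (-M) M, |fderiv ℝ D z (0, 1)| ≤ ε * (2 * M) := by
    rintro ⟨x, y⟩ ⟨hx, hy⟩
    refine abs_le_of_hasDerivAt hM (fun x => hasDerivAt_slice_fst hd2 x y)
      (fun t ht => by rw [← mixedDeriv_symm hD]; exact hb (t, y) ⟨ht, hy⟩) ?_ hx
    rw [← (hasDerivAt_slice_snd hd (-M) y).deriv]
    simp [hx0]
  refine fun z hz => ⟨h1 z hz, h2 z hz, ?_⟩
  obtain ⟨x, y⟩ := z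
  exact abs_le_of_hasDerivAt hM (fun x => hasDerivAt_slice_fst hd x y)
    (fun t ht => h1 (t, y) ⟨ht, hz.2⟩) (hx0 y) hz.1

theorem IsTestFunction.exists_bound {E : Type*} [NormedAddCommGroup E] [NormedSpace ℝ E]
    {Ω : Set E} {φ : E → ℝ} (hφ : IsTestFunction Ω φ) (v : E) :
    ∃ C : ℝ, (∀ z, |φ z| ≤ C) ∧ ∀ z, |fderiv ℝ φ z v| ≤ C := by
  obtain ⟨C, hC⟩ := hφ.1.continuous.bounded_above_of_compact_support hφ.2.1
  obtain ⟨C', hC'⟩ := (hφ.continuous_fderiv_apply v).bounded_above_of_compact_support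
    (hφ.2.1.fderiv_apply (𝕜 := ℝ) v)
  exact ⟨max C C', fun z => (hC z).trans (le_max_left _ _),
    fun z => (hC' z).trans (le_max_right _ _)⟩

/-- Test functions on a product are approximated in `C¹` by finite sums of tensor products of
test functions. -/
theorem exists_testTensors_near {Ωx Ωy : Set ℝ} (hΩx : IsOpen Ωx) (hΩy : IsOpen Ωy)
    (hbx : Bornology.IsBounded Ωx) (hby : Bornology.IsBounded Ωy) {φ : ℝ × ℝ → ℝ}
    (hφ : IsTestFunction (Ωx ×ˢ Ωy) φ) {ε : ℝ} (hε : 0 < ε) :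
    ∃ T ∈ testTensors Ωx Ωy, ∀ z ∈ Ωx ×ˢ Ωy, |fderiv ℝ T z (1, 0) - fderiv ℝ φ z (1, 0)| ≤ ε ∧
      |fderiv ℝ T z (0, 1) - fderiv ℝ φ z (0, 1)| ≤ ε := by
  obtain ⟨M, hM, hMΩ⟩ : ∃ M : ℝ, 0 < M ∧ Ωx ∪ Ωy ⊆ Metric.ball 0 M := by
    obtain ⟨M, hM⟩ := (hbx.union hby).subset_ball 0
    exact ⟨max M 1, by positivity, hM.trans (Metric.ball_subset_ball (le_max_left _ _))⟩
  have hM' : ∀ x ∈ Ωx ∪ Ωy, -M < x ∧ x < M := fun x hx => by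
    have := hMΩ hx
    rwa [Metric.mem_ball, dist_zero_right, Real.norm_eq_abs, abs_lt] at this
  -- The cutoffs equal 1 on the two projections of supp φ, so multiplying φ by χ ⊗ η changes
  -- nothing.
  obtain ⟨χ, hχ, hχ1⟩ := exists_isTestFunction_eq_one hΩx (hφ.2.1.image continuous_fst)
    (by rintro _ ⟨z, hz, rfl⟩; exact (hφ.2.2 hz).1)
  obtain ⟨η, hη, hη1⟩ := exists_isTestFunction_eq_one hΩy (hφ.2.1.image continuous_snd)
    (by rintro _ ⟨z, hz, rfl⟩; exact (hφ.2.2 hz).2)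
  have hκ := hχ.tensor hη
  have hκφ : tensor χ η * φ = φ := by
    ext z
    by_cases hz : z ∈ tsupport φ
    · simp [tensor, hχ1 z.1 ⟨z, hz, rfl⟩, hη1 z.2 ⟨z, hz, rfl⟩]
    · simp [image_eq_zero_of_notMem_tsupport hz]
  obtain ⟨C₁, hC₁, hC₁'⟩ := hκ.exists_bound (1, 0)
  obtain ⟨C₂, hC₂, hC₂'⟩ := hκ.exists_bound (0, 1)
  have hC₁0 : 0 ≤ C₁ := (abs_nonneg _).trans (hC₁ 0)
  have hC₂0 : 0 ≤ C₂ := (abs_nonneg _).trans (hC₂ 0)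
  set C := C₁ + C₂ with hC
  -- The product rule leaves an error of at most δ * (C * (2 * M * (1 + 2 * M))); `C + 1` keeps the
  -- denominator positive.
  set δ := ε / ((C + 1) * (2 * M * (1 + 2 * M))) with hδ
  have hδ0 : 0 < δ := by positivity
  have hcont : Continuous (mixedDeriv φ) :=
    (contDiff_fderiv_apply (contDiff_fderiv_apply hφ.1 _) _).continuous
  obtain ⟨S, hS, hSφ⟩ := exists_smoothTensors_near
    ((isCompact_Icc (a := -M) (b := M)).prod (isCompact_Icc (a := -M) (b := M))) hcont hδ0
  -- The point -M lies outside both domains, so φ vanishes on the same two lines as U, and U - φ is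
  -- controlled by its mixed derivative.
  obtain ⟨U, hU, rfl, hU1, hU2, hUT⟩ := exists_mixedDeriv_eq hS (-M)
  set D := U + (-1 : ℝ) • φ with hDdef
  have hφs : ContDiff ℝ ∞ ((-1 : ℝ) • φ) := hφ.1.const_smul (-1 : ℝ)
  have hDs : ContDiff ℝ ∞ D := hU.add hφs
  have hmix : ∀ z, mixedDeriv D z = mixedDeriv U z - mixedDeriv φ z := fun z => by
    rw [hDdef, mixedDeriv_add hU hφs, mixedDeriv_const_smul hφ.1]
    simp [sub_eq_add_neg]
  have hφx : ∀ y, φ (-M, y) = 0 := fun y =>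
    hφ.eq_zero fun h => lt_irrefl _ (hM' (-M) (Or.inl h.1)).1
  have hφy : ∀ x, φ (x, -M) = 0 := fun x =>
    hφ.eq_zero fun h => lt_irrefl _ (hM' (-M) (Or.inr h.2)).1
  have key := abs_fderiv_le_of_mixedDeriv_le hDs hM.le (ε := δ)
    (fun y => by simp [hDdef, hU1, hφx]) (fun x => by simp [hDdef, hU2, hφy])
    (fun z hz => by rw [hmix]; exact hSφ z hz)
  have hdκ := hκ.differentiable
  have hT : tensor χ η * U = tensor χ η * D + φ := by
    conv_rhs => rw [← hκφ]
    rw [hDdef]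
    ext z
    simp only [Pi.mul_apply, Pi.add_apply, Pi.smul_apply, smul_eq_mul, congrFun hκφ z]
    have := congrFun hκφ z
    simp only [Pi.mul_apply] at this
    rw [mul_add, mul_left_comm, this]
    ring
  have hdiff : ∀ z v, fderiv ℝ (tensor χ η * U) z v - fderiv ℝ φ z v =
      tensor χ η z * fderiv ℝ D z v + D z * fderiv ℝ (tensor χ η) z v := by
    intro z v
    have hdD := hDs.differentiable (by simp) z
    rw [hT, fderiv_add ((hdκ z).mul hdD) (hφ.differentiable z), fderiv_mul (hdκ z) hdD]
    simp
  have hfin : ∀ {k a d b c : ℝ}, |k| ≤ c → |b| ≤ c → c ≤ C → |a| ≤ δ * (2 * M) →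
      |d| ≤ δ * (2 * M) * (2 * M) → |k * a + d * b| ≤ ε := by
    intro k a d b c hk hb hc ha hd
    have hCC : 0 ≤ C := by positivity
    calc |k * a + d * b| ≤ |k| * |a| + |d| * |b| := by
          rw [← abs_mul, ← abs_mul]; exact abs_add_le _ _
      _ ≤ C * (δ * (2 * M)) + δ * (2 * M) * (2 * M) * C := by
          gcongr
          · exact hk.trans hc
          · exact hb.trans hc
      _ = δ * (C * (2 * M * (1 + 2 * M))) := by ring
      _ ≤ δ * ((C + 1) * (2 * M * (1 + 2 * M))) := by gcongr; linarith
      _ = ε := by rw [hδ]; field_simp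
  refine ⟨tensor χ η * U, hUT _ _ _ _ hχ hη, fun z hz => ?_⟩
  obtain ⟨k1, k2, k3⟩ := key z ⟨⟨(hM' _ (Or.inl hz.1)).1.le, (hM' _ (Or.inl hz.1)).2.le⟩,
    ⟨(hM' _ (Or.inr hz.2)).1.le, (hM' _ (Or.inr hz.2)).2.le⟩⟩
  rw [hdiff, hdiff]
  exact ⟨hfin (hC₁ z) (hC₁' z) (by linarith) k1 k3, hfin (hC₂ z) (hC₂' z) (by linarith) k2 k3⟩

theorem isTestFunction_of_mem_testTensors {Ωx Ωy : Set ℝ} {T : ℝ × ℝ → ℝ}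
    (hT : T ∈ testTensors Ωx Ωy) : IsTestFunction (Ωx ×ˢ Ωy) T := by
  unfold testTensors at hT
  induction hT using Submodule.span_induction with
  | mem x hx =>
    obtain ⟨p, q, hp, hq, rfl⟩ := hx
    exact hp.tensor hq
  | zero => exact isTestFunction_zero _
  | add x y _ _ hx hy => exact hx.add hy
  | smul c x _ hx => exact hx.const_smul c

end Density

/-! ### The orthogonal greedy algorithm in an inner product space. -/

section OrthogonalGreedy

variable {H : Type*} [NormedAddCommGroup H] [InnerProductSpace ℝ H]

theorem inner_eq_zero_of_forall_le {G w : H}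
    (h : ∀ c : ℝ, 0 ≤ (1 / 2) * inner ℝ (c • w) (c • w) - inner ℝ G (c • w)) :
    inner ℝ G w = 0 := by
  by_contra hne
  simp only [inner_smul_left, inner_smul_right, RCLike.conj_to_real] at h
  set a := inner ℝ G w with ha
  set b := inner ℝ w w with hb
  have hb0 : 0 ≤ b := real_inner_self_nonneg
  -- Nearly the optimal c = a / b; adding 1 covers w = 0 and still makes the energy negative when a
  -- ≠ 0.
  have h1 := h (a / (b + 1))
  have hb1 : 0 < b + 1 := by linarith
  have e : (1 / 2) * (a / (b + 1) * (a / (b + 1) * b)) - a / (b + 1) * a =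
      - (a ^ 2 * (b / 2 + 1) / (b + 1) ^ 2) := by
    field_simp; ring
  rw [e] at h1
  have : 0 < a ^ 2 * (b / 2 + 1) / (b + 1) ^ 2 := by positivity
  linarith

/-- A minimizer of the quadratic energy over a cone attains the norm of the linear form on it. -/
theorem abs_inner_le_of_minimizer {G t : H} {D : Set H} (hD : ∀ d ∈ D, ∀ c : ℝ, c • d ∈ D)
    (ht : t ∈ D)
    (h : ∀ d ∈ D, (1 / 2) * inner ℝ t t - inner ℝ G t ≤ (1 / 2) * inner ℝ d d - inner ℝ G d) :
    inner ℝ t t = inner ℝ G t ∧ ∀ d ∈ D, |inner ℝ G d| ≤ ‖t‖ * ‖d‖ := by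
  have h1 : inner ℝ t t = inner ℝ G t := by
    have : inner ℝ (G - t) t = 0 := by
      refine inner_eq_zero_of_forall_le fun c => ?_
      -- Moving along the ray through t changes the energy by exactly the energy of c • t for the
      -- form G - t.
      have := h _ (hD t ht (1 + c))
      simp only [inner_smul_left, inner_smul_right, RCLike.conj_to_real, inner_sub_left] at this ⊢
      linarith
    rw [inner_sub_left] at this
    linarith
  refine ⟨h1, fun d hd => ?_⟩
  -- Minimality against c • d, doubled, with the minimal energy equal to -‖t‖²/2; the discriminant
  -- then gives the bound.
  have h2 : ∀ c : ℝ, 0 ≤ inner ℝ d d * (c * c) + (-2 * inner ℝ G d) * c + inner ℝ t t := by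
    intro c
    have := h _ (hD d hd c)
    simp only [inner_smul_left, inner_smul_right, RCLike.conj_to_real] at this
    linarith
  have h3 := discrim_le_zero h2
  refine abs_le_of_sq_le_sq ?_ (by positivity)
  rw [discrim] at h3
  rw [mul_pow, ← real_inner_self_eq_norm_sq, ← real_inner_self_eq_norm_sq]
  linarith

variable {G : H} {t : ℕ → H} {α : ℕ → ℕ → ℝ}

/-- Galerkin orthogonality: the first variation of the energy at the minimizing coefficients
vanishes. -/
theorem inner_residual_galerkin
    (h : ∀ (n : ℕ) (β : ℕ → ℝ),
      (1 / 2) * inner ℝ (∑ k ∈ Finset.range n, α n k • t k) (∑ k ∈ Finset.range n, α n k • t k) -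
        inner ℝ G (∑ k ∈ Finset.range n, α n k • t k) ≤
      (1 / 2) * inner ℝ (∑ k ∈ Finset.range n, β k • t k) (∑ k ∈ Finset.range n, β k • t k) -
        inner ℝ G (∑ k ∈ Finset.range n, β k • t k)) (n : ℕ) (β : ℕ → ℝ) :
    inner ℝ (G - ∑ k ∈ Finset.range n, α n k • t k) (∑ k ∈ Finset.range n, β k • t k) = 0 := by
  refine inner_eq_zero_of_forall_le fun c => ?_
  have := h n (fun k => α n k + c * β k)
  have e : ∑ k ∈ Finset.range n, (α n k + c * β k) • t k =
      ∑ k ∈ Finset.range n, α n k • t k + c • ∑ k ∈ Finset.range n, β k • t k := by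
    simp only [add_smul, mul_smul, Finset.sum_add_distrib, Finset.smul_sum]
  rw [e] at this
  set P := ∑ k ∈ Finset.range n, α n k • t k
  set Q := c • ∑ k ∈ Finset.range n, β k • t k
  rw [inner_add_left, inner_add_right, inner_add_right, inner_add_right,
    real_inner_comm P Q] at this
  rw [inner_sub_left]
  linarith

theorem sum_norm_sq_le_of_galerkin
    (h : ∀ (n : ℕ) (β : ℕ → ℝ),
      (1 / 2) * inner ℝ (∑ k ∈ Finset.range n, α n k • t k) (∑ k ∈ Finset.range n, α n k • t k) -
        inner ℝ G (∑ k ∈ Finset.range n, α n k • t k) ≤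
      (1 / 2) * inner ℝ (∑ k ∈ Finset.range n, β k • t k) (∑ k ∈ Finset.range n, β k • t k) -
        inner ℝ G (∑ k ∈ Finset.range n, β k • t k))
    (ht : ∀ n, inner ℝ (t n) (t n) = inner ℝ (G - ∑ k ∈ Finset.range n, α n k • t k) (t n))
    (n : ℕ) :
    ‖G - ∑ k ∈ Finset.range n, α n k • t k‖ ^ 2 + ∑ k ∈ Finset.range n, ‖t k‖ ^ 2 ≤ ‖G‖ ^ 2 := by
  induction n with
  | zero => simp
  | succ n ih =>
    refine le_trans ?_ ih
    -- The competitor keeps the old coefficients and adds `t n` with coefficient 1.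
    have h1 := h (n + 1) (fun k => if k < n then α n k else 1)
    have e : ∑ k ∈ Finset.range (n + 1), (if k < n then α n k else 1) • t k =
        ∑ k ∈ Finset.range n, α n k • t k + t n := by
      rw [Finset.sum_range_succ]
      simp only [lt_irrefl, if_false, one_smul]
      congr 1
      exact Finset.sum_congr rfl fun k hk => by rw [if_pos (Finset.mem_range.1 hk)]
    rw [e] at h1
    have h2 := ht n
    rw [Finset.sum_range_succ (fun k => ‖t k‖ ^ 2)]
    set P := ∑ k ∈ Finset.range n, α n k • t k
    set Q := ∑ k ∈ Finset.range (n + 1), α (n + 1) k • t k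
    rw [inner_sub_left] at h2
    rw [inner_add_left, inner_add_right, inner_add_right, inner_add_right,
      real_inner_comm P (t n)] at h1
    rw [norm_sub_sq_real, norm_sub_sq_real]
    simp only [← real_inner_self_eq_norm_sq]
    linarith

theorem summable_norm_sq_of_galerkin
    (h : ∀ (n : ℕ) (β : ℕ → ℝ),
      (1 / 2) * inner ℝ (∑ k ∈ Finset.range n, α n k • t k) (∑ k ∈ Finset.range n, α n k • t k) -
        inner ℝ G (∑ k ∈ Finset.range n, α n k • t k) ≤
      (1 / 2) * inner ℝ (∑ k ∈ Finset.range n, β k • t k) (∑ k ∈ Finset.range n, β k • t k) -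
        inner ℝ G (∑ k ∈ Finset.range n, β k • t k))
    (ht : ∀ n, inner ℝ (t n) (t n) = inner ℝ (G - ∑ k ∈ Finset.range n, α n k • t k) (t n)) :
    Summable fun n => ‖t n‖ ^ 2 :=
  summable_of_sum_range_le (c := ‖G‖ ^ 2) (fun _ => by positivity) fun n =>
    le_trans (le_add_of_nonneg_left (by positivity)) (sum_norm_sq_le_of_galerkin h ht n)

/-- Weak convergence on span D becomes strong because ‖R n‖² = ⟨R n, G⟩ and G is a limit of elements
of that span. -/
theorem tendsto_norm_residual_of_galerkin {D : Set H} (hD : ∀ d ∈ D, ∀ c : ℝ, c • d ∈ D)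
    (hG : G ∈ closure (Submodule.span ℝ D : Set H)) (htD : ∀ n, t n ∈ D)
    (h : ∀ (n : ℕ) (β : ℕ → ℝ),
      (1 / 2) * inner ℝ (∑ k ∈ Finset.range n, α n k • t k) (∑ k ∈ Finset.range n, α n k • t k) -
        inner ℝ G (∑ k ∈ Finset.range n, α n k • t k) ≤
      (1 / 2) * inner ℝ (∑ k ∈ Finset.range n, β k • t k) (∑ k ∈ Finset.range n, β k • t k) -
        inner ℝ G (∑ k ∈ Finset.range n, β k • t k))
    (hmin : ∀ n, ∀ d ∈ D,
      (1 / 2) * inner ℝ (t n) (t n) - inner ℝ (G - ∑ k ∈ Finset.range n, α n k • t k) (t n) ≤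
      (1 / 2) * inner ℝ d d - inner ℝ (G - ∑ k ∈ Finset.range n, α n k • t k) d) :
    Tendsto (fun n => ‖G - ∑ k ∈ Finset.range n, α n k • t k‖) atTop (𝓝 0) := by
  set R : ℕ → H := fun n => G - ∑ k ∈ Finset.range n, α n k • t k with hR
  have hm := fun n => abs_inner_le_of_minimizer hD (htD n) (hmin n)
  have hle : ∀ n, ‖R n‖ ≤ ‖G‖ := fun n => by
    have := sum_norm_sq_le_of_galerkin h (fun n => (hm n).1) n
    have h2 : 0 ≤ ∑ k ∈ Finset.range n, ‖t k‖ ^ 2 := Finset.sum_nonneg fun _ _ => by positivity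
    exact le_of_sq_le_sq (by simp only [hR]; linarith) (norm_nonneg _)
  have ht0 : Tendsto (fun n => ‖t n‖) atTop (𝓝 0) := by
    have := (summable_norm_sq_of_galerkin h (fun n => (hm n).1)).tendsto_atTop_zero
    simpa using this.sqrt
  have hweak : ∀ d ∈ Submodule.span ℝ D, Tendsto (fun n => inner ℝ (R n) d) atTop (𝓝 0) := by
    intro d hd
    induction hd using Submodule.span_induction with
    | mem d hd =>
      refine squeeze_zero_norm (fun n => (hm n).2 d hd) ?_
      simpa using ht0.mul_const ‖d‖
    | zero => simp
    | add x y _ _ hx hy => simpa [inner_add_right] using hx.add hy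
    | smul c x _ hx => simpa [inner_smul_right] using hx.const_mul c
  have hsq : Tendsto (fun n => ‖R n‖ ^ 2) atTop (𝓝 0) := by
    rw [Metric.tendsto_atTop]
    intro ε hε
    obtain ⟨d, hd, hdG⟩ := Metric.mem_closure_iff.1 hG (ε / (2 * (‖G‖ + 1))) (by positivity)
    obtain ⟨N, hN⟩ := Metric.tendsto_atTop.1 (hweak d hd) (ε / 2) (by positivity)
    refine ⟨N, fun n hn => ?_⟩
    have h1 := hN n hn
    rw [Real.dist_eq, sub_zero] at h1 ⊢
    rw [abs_of_nonneg (by positivity)]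
    -- By orthogonality ⟨R n, R n⟩ = ⟨R n, G⟩; the first term is small by the choice of d, the
    -- second by weak convergence.
    have e : ‖R n‖ ^ 2 = inner ℝ (R n) (G - d) + inner ℝ (R n) d := by
      rw [← inner_add_right, sub_add_cancel, ← real_inner_self_eq_norm_sq]
      have := inner_residual_galerkin h n (α n)
      conv_lhs => rw [hR]
      simp only
      rw [inner_sub_right, this, sub_zero]
    have h2 : inner ℝ (R n) (G - d) ≤ ‖G‖ * (ε / (2 * (‖G‖ + 1))) := by
      refine (real_inner_le_norm _ _).trans ?_
      rw [dist_eq_norm] at hdG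
      gcongr
      exact hle n
    have h3 : ‖G‖ * (ε / (2 * (‖G‖ + 1))) ≤ ε / 2 := by
      rw [mul_div_assoc', div_le_div_iff₀ (by positivity) (by positivity)]
      nlinarith [norm_nonneg G]
    rw [e]
    linarith [le_abs_self (inner ℝ (R n) d)]
  simpa using hsq.sqrt

end OrthogonalGreedy

/-! ### The gradient embedding into L²(Ω)². -/

section Gradient

/-- `L²(Ω)²`. -/
abbrev GradSpace (Ω : Set (ℝ × ℝ)) : Type :=
  WithLp 2 (Lp ℝ 2 ((volume : Measure (ℝ × ℝ)).restrict Ω) ×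
    Lp ℝ 2 ((volume : Measure (ℝ × ℝ)).restrict Ω))

/-- The distributional gradient as an element of `L²(Ω)²`. -/
noncomputable def grad (Ω : Set (ℝ × ℝ)) (u : ℝ × ℝ → ℝ) : GradSpace Ω :=
  WithLp.toLp 2 ((memLp_weakDeriv Ω (1, 0) u).toLp, (memLp_weakDeriv Ω (0, 1) u).toLp)

theorem inner_grad (Ω : Set (ℝ × ℝ)) (u v : ℝ × ℝ → ℝ) :
    inner ℝ (grad Ω u) (grad Ω v) = dirichletInner Ω u v := by
  have e : ∀ d : ℝ × ℝ, inner ℝ (memLp_weakDeriv Ω d u).toLp (memLp_weakDeriv Ω d v).toLp =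
      ∫ z in Ω, weakDeriv Ω d u z * weakDeriv Ω d v z := by
    intro d
    rw [L2.inner_def]
    refine integral_congr_ae ?_
    filter_upwards [(memLp_weakDeriv Ω d u).coeFn_toLp, (memLp_weakDeriv Ω d v).coeFn_toLp]
      with z h1 h2
    simp [h1, h2, mul_comm]
  rw [WithLp.prod_inner_apply, dirichletInner, integral_add]
  · exact congrArg₂ (· + ·) (e (1, 0)) (e (0, 1))
  · exact (memLp_weakDeriv Ω (1, 0) u).integrable_mul (memLp_weakDeriv Ω (1, 0) v)
  · exact (memLp_weakDeriv Ω (0, 1) u).integrable_mul (memLp_weakDeriv Ω (0, 1) v)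

theorem dirichletNorm_eq (Ω : Set (ℝ × ℝ)) (u : ℝ × ℝ → ℝ) :
    dirichletNorm Ω u = ‖grad Ω u‖ := by
  rw [dirichletNorm, ← inner_grad, real_inner_self_eq_norm_sq, Real.sqrt_sq (norm_nonneg _)]

variable {Ω : Set (ℝ × ℝ)} (hΩ : IsOpen Ω)

include hΩ

/-- The chosen weak derivatives add only almost everywhere, which is equality in `Lp`. -/
theorem grad_add {u v : ℝ × ℝ → ℝ} (hu : MemH10 Ω u) (hv : MemH10 Ω v) :
    grad Ω (u + v) = grad Ω u + grad Ω v := by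
  have e : ∀ d : ℝ × ℝ, (memLp_weakDeriv Ω d (u + v)).toLp =
      (memLp_weakDeriv Ω d u).toLp + (memLp_weakDeriv Ω d v).toLp := fun d => by
    rw [← MemLp.toLp_add]
    exact MemLp.toLp_congr _ _ ((hu.add hΩ hv).2 d)
  rw [grad, e, e]
  rfl

theorem grad_const_smul {u : ℝ × ℝ → ℝ} (hu : MemH10 Ω u) (c : ℝ) :
    grad Ω (c • u) = c • grad Ω u := by
  have e : ∀ d : ℝ × ℝ, (memLp_weakDeriv Ω d (c • u)).toLp =
      c • (memLp_weakDeriv Ω d u).toLp := fun d => by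
    rw [← MemLp.toLp_const_smul]
    exact MemLp.toLp_congr _ _ ((hu.const_smul hΩ c).2 d)
  rw [grad, e, e]
  rfl

theorem tendsto_grad_of_tendsto_eLpNorm {u : ℕ → ℝ × ℝ → ℝ} {w : ℝ × ℝ → ℝ}
    (hu : ∀ k, IsTestFunction Ω (u k))
    (h : ∀ d ∈ ({(1, 0), (0, 1)} : Set (ℝ × ℝ)), Tendsto (fun k => eLpNorm
      (fun z => fderiv ℝ (u k) z d - weakDeriv Ω d w z) 2 (volume.restrict Ω)) atTop (𝓝 0)) :
    Tendsto (fun k => grad Ω (u k)) atTop (𝓝 (grad Ω w)) := by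
  have e : ∀ d ∈ ({(1, 0), (0, 1)} : Set (ℝ × ℝ)),
      Tendsto (fun k => (memLp_weakDeriv Ω d (u k)).toLp) atTop
        (𝓝 (memLp_weakDeriv Ω d w).toLp) := by
    intro d hd
    refine (Lp.tendsto_Lp_iff_tendsto_eLpNorm'' _ _ _ _).2 ((h d hd).congr fun k => ?_)
    refine eLpNorm_congr_ae ?_
    filter_upwards [((hu k).memH10 hΩ).2 d] with z hz
    rw [Pi.sub_apply, hz]
  exact ((WithLp.prod_continuous_toLp 2 _ _).tendsto _).comp
    ((e _ (by simp)).prodMk_nhds (e _ (by simp)))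

omit hΩ

/-- The gradients of the elements of `H¹₀(Ω)` of the form `p ⊗ q`. -/
def gradTensors (Ωx Ωy : Set ℝ) : Set (GradSpace (Ωx ×ˢ Ωy)) :=
  {d | ∃ p q, MemH10 Ωx p ∧ MemH10 Ωy q ∧ d = grad (Ωx ×ˢ Ωy) (tensor p q)}

variable {Ωx Ωy : Set ℝ} (hΩx : IsOpen Ωx) (hΩy : IsOpen Ωy)

include hΩx hΩy

theorem smul_mem_gradTensors {d : GradSpace (Ωx ×ˢ Ωy)} (hd : d ∈ gradTensors Ωx Ωy) (c : ℝ) :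
    c • d ∈ gradTensors Ωx Ωy := by
  obtain ⟨p, q, hp, hq, rfl⟩ := hd
  refine ⟨c • p, q, (hp.const_smul hΩx c).1, hq, ?_⟩
  rw [← grad_const_smul (hΩx.prod hΩy) (hp.tensor hΩx hΩy hq)]
  congr 1
  ext z
  simp only [tensor, Pi.smul_apply, smul_eq_mul]
  ring

theorem grad_mem_span_of_mem_testTensors {T : ℝ × ℝ → ℝ} (hT : T ∈ testTensors Ωx Ωy) :
    grad (Ωx ×ˢ Ωy) T ∈ Submodule.span ℝ (gradTensors Ωx Ωy) := by
  have hΩ := hΩx.prod hΩy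
  have hmem : ∀ T ∈ testTensors Ωx Ωy, MemH10 (Ωx ×ˢ Ωy) T := fun T hT =>
    ((isTestFunction_of_mem_testTensors hT).memH10 hΩ).1
  unfold testTensors at hT hmem
  induction hT using Submodule.span_induction with
  | mem x hx =>
    obtain ⟨p, q, hp, hq, rfl⟩ := hx
    exact Submodule.subset_span ⟨p, q, (hp.memH10 hΩx).1, (hq.memH10 hΩy).1, rfl⟩
  | zero =>
    -- Homogeneity with factor 0 shows that the zero function has zero gradient, despite the choice
    -- in `weakDeriv`.
    have := grad_const_smul hΩ ((isTestFunction_zero (Ωx ×ˢ Ωy)).memH10 hΩ).1 0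
    rw [zero_smul, zero_smul] at this
    rw [this]
    exact Submodule.zero_mem _
  | add x y hx' hy' hx hy =>
    rw [grad_add hΩ (hmem x hx') (hmem y hy')]
    exact Submodule.add_mem _ hx hy
  | smul c x hx' hx =>
    rw [grad_const_smul hΩ (hmem x hx')]
    exact Submodule.smul_mem _ _ hx

/-- The span of the tensor products is dense in `H¹₀(Ωx × Ωy)`. -/
theorem grad_mem_closure_span (hbx : Bornology.IsBounded Ωx) (hby : Bornology.IsBounded Ωy)
    {u : ℝ × ℝ → ℝ} (hu : MemH10 (Ωx ×ˢ Ωy) u) :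
    grad (Ωx ×ˢ Ωy) u ∈
      closure (Submodule.span ℝ (gradTensors Ωx Ωy) : Set (GradSpace (Ωx ×ˢ Ωy))) := by
  have hΩ := hΩx.prod hΩy
  have htest : ∀ φ, IsTestFunction (Ωx ×ˢ Ωy) φ → grad (Ωx ×ˢ Ωy) φ ∈
      closure (Submodule.span ℝ (gradTensors Ωx Ωy) : Set (GradSpace (Ωx ×ˢ Ωy))) := by
    intro φ hφ
    choose T hT hTφ using fun k : ℕ => exists_testTensors_near hΩx hΩy hbx hby hφ
      (Nat.one_div_pos_of_nat (α := ℝ) (n := k))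
    refine mem_closure_of_tendsto (tendsto_grad_of_tendsto_eLpNorm hΩ
      (fun k => isTestFunction_of_mem_testTensors (hT k)) ?_)
      (Eventually.of_forall fun k => grad_mem_span_of_mem_testTensors hΩx hΩy (hT k))
    intro d hd
    set μ := (volume : Measure (ℝ × ℝ)).restrict (Ωx ×ˢ Ωy)
    have hfin : μ Set.univ ≠ ⊤ := by
      simpa [μ] using (hbx.prod hby).measure_lt_top.ne
    -- On a set of finite measure the uniform error 1 / (k + 1) bounds the L² error up to the factor
    -- μ(Ω)^(1/2).
    have hb : Tendsto (fun k : ℕ => μ Set.univ ^ (2 : ℝ≥0∞).toReal⁻¹ *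
        ENNReal.ofReal (1 / ((k : ℝ) + 1))) atTop (𝓝 0) := by
      have := ENNReal.Tendsto.const_mul (a := μ Set.univ ^ (2 : ℝ≥0∞).toReal⁻¹)
        (ENNReal.tendsto_ofReal (tendsto_one_div_add_atTop_nhds_zero_nat (𝕜 := ℝ)))
        (Or.inr (ENNReal.rpow_ne_top_of_nonneg (by positivity) hfin))
      simpa using this
    refine tendsto_eLpNorm_of_le hb fun k => eLpNorm_le_of_ae_bound ?_
    filter_upwards [(hφ.memH10 hΩ).2 d, ae_restrict_mem hΩ.measurableSet] with z hz hzΩ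
    rw [hz, Real.norm_eq_abs]
    rcases hd with rfl | rfl
    · exact (hTφ k z hzΩ).1
    · exact (hTφ k z hzΩ).2
  obtain ⟨_, φ, hφ, -, h1⟩ := hu
  rw [← closure_closure]
  exact mem_closure_of_tendsto (tendsto_grad_of_tendsto_eLpNorm hΩ hφ fun d _ => h1 d)
    (Eventually.of_forall fun k => htest _ (hφ k))

end Gradient

/-! ### Translation of the algorithm into L²(Ω)². -/

section Algorithm

variable {Ωx Ωy : Set ℝ} (hΩx : IsOpen Ωx) (hΩy : IsOpen Ωy) {f g : ℝ × ℝ → ℝ}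
  {r s : ℕ → ℝ → ℝ} {α : ℕ → ℕ → ℝ}

include hΩx hΩy

theorem tensorSum_mem (hr : ∀ n, MemH10 Ωx (r n)) (hs : ∀ n, MemH10 Ωy (s n)) (β : ℕ → ℝ)
    (n : ℕ) : MemH10 (Ωx ×ˢ Ωy) (tensorSum r s β n) ∧ grad (Ωx ×ˢ Ωy) (tensorSum r s β n) =
      ∑ k ∈ Finset.range n, β k • grad (Ωx ×ˢ Ωy) (tensor (r k) (s k)) := by
  have hΩ := hΩx.prod hΩy
  have ht := fun k => (hr k).tensor hΩx hΩy (hs k)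
  induction n with
  | zero =>
    have h0 : tensorSum r s β 0 = 0 := by ext z; simp [tensorSum]
    have hm := ((isTestFunction_zero (Ωx ×ˢ Ωy)).memH10 hΩ).1
    have := grad_const_smul hΩ hm 0
    rw [zero_smul, zero_smul] at this
    rw [h0, this]
    exact ⟨hm, by simp⟩
  | succ n ih =>
    have h1 : tensorSum r s β (n + 1) = tensorSum r s β n + β n • tensor (r n) (s n) := by
      ext z
      simp [tensorSum, Finset.sum_range_succ]
    have h2 := ((ht n).const_smul hΩ (β n)).1
    rw [h1, grad_add hΩ ih.1 h2, ih.2, grad_const_smul hΩ (ht n), Finset.sum_range_succ]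
    exact ⟨(ih.1.add hΩ h2).1, rfl⟩

/-- The weak equation for g replaces ∫ f v by ⟨g, v⟩. -/
theorem stepResidual_eq (hg : IsDirichletSolution (Ωx ×ˢ Ωy) f g)
    (hr : ∀ n, MemH10 Ωx (r n)) (hs : ∀ n, MemH10 Ωy (s n)) (n : ℕ) {v : ℝ × ℝ → ℝ}
    (hv : MemH10 (Ωx ×ˢ Ωy) v) :
    stepResidual (Ωx ×ˢ Ωy) f r s α n v =
      inner ℝ (grad (Ωx ×ˢ Ωy) g - ∑ k ∈ Finset.range n,
        α n k • grad (Ωx ×ˢ Ωy) (tensor (r k) (s k))) (grad (Ωx ×ˢ Ωy) v) := by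
  rw [stepResidual, residual, ← hg.2 v hv, inner_sub_left, inner_grad,
    ← (tensorSum_mem hΩx hΩy hr hs (α n) n).2, inner_grad]

theorem IsGalerkin.grad_le (hα : IsGalerkin (Ωx ×ˢ Ωy) f r s α)
    (hg : IsDirichletSolution (Ωx ×ˢ Ωy) f g)
    (hr : ∀ n, MemH10 Ωx (r n)) (hs : ∀ n, MemH10 Ωy (s n)) (n : ℕ) (β : ℕ → ℝ) :
    (1 / 2) * inner ℝ
        (∑ k ∈ Finset.range n, α n k • grad (Ωx ×ˢ Ωy) (tensor (r k) (s k)))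
        (∑ k ∈ Finset.range n, α n k • grad (Ωx ×ˢ Ωy) (tensor (r k) (s k))) -
      inner ℝ (grad (Ωx ×ˢ Ωy) g)
        (∑ k ∈ Finset.range n, α n k • grad (Ωx ×ˢ Ωy) (tensor (r k) (s k))) ≤
    (1 / 2) * inner ℝ
        (∑ k ∈ Finset.range n, β k • grad (Ωx ×ˢ Ωy) (tensor (r k) (s k)))
        (∑ k ∈ Finset.range n, β k • grad (Ωx ×ˢ Ωy) (tensor (r k) (s k))) -
      inner ℝ (grad (Ωx ×ˢ Ωy) g)
        (∑ k ∈ Finset.range n, β k • grad (Ωx ×ˢ Ωy) (tensor (r k) (s k))) := by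
  have h := hα n β
  have hm := fun β => tensorSum_mem hΩx hΩy hr hs β n
  simp only [energy] at h
  rw [← hg.2 _ (hm (α n)).1, ← hg.2 _ (hm β).1] at h
  simpa only [← inner_grad, (hm _).2] using h

theorem stepEnergy_eq (hg : IsDirichletSolution (Ωx ×ˢ Ωy) f g)
    (hr : ∀ n, MemH10 Ωx (r n)) (hs : ∀ n, MemH10 Ωy (s n)) (n : ℕ) {p q : ℝ → ℝ}
    (hp : MemH10 Ωx p) (hq : MemH10 Ωy q) :
    energy (Ωx ×ˢ Ωy) (stepResidual (Ωx ×ˢ Ωy) f r s α n) (tensor p q) =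
      (1 / 2) * inner ℝ (grad (Ωx ×ˢ Ωy) (tensor p q)) (grad (Ωx ×ˢ Ωy) (tensor p q)) -
      inner ℝ (grad (Ωx ×ˢ Ωy) g - ∑ k ∈ Finset.range n,
        α n k • grad (Ωx ×ˢ Ωy) (tensor (r k) (s k))) (grad (Ωx ×ˢ Ωy) (tensor p q)) := by
  rw [energy, stepResidual_eq hΩx hΩy hg hr hs n (hp.tensor hΩx hΩy hq), inner_grad]

theorem IsEulerLagrangeOGA.inner_self_eq (h : IsEulerLagrangeOGA Ωx Ωy f r s α)
    (hg : IsDirichletSolution (Ωx ×ˢ Ωy) f g) (n : ℕ) :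
    inner ℝ (grad (Ωx ×ˢ Ωy) (tensor (r n) (s n))) (grad (Ωx ×ˢ Ωy) (tensor (r n) (s n))) =
      inner ℝ (grad (Ωx ×ˢ Ωy) g - ∑ k ∈ Finset.range n,
        α n k • grad (Ωx ×ˢ Ωy) (tensor (r k) (s k)))
        (grad (Ωx ×ˢ Ωy) (tensor (r n) (s n))) := by
  -- With p = `r n` and q = 0 the test direction is r_n ⊗ s_n itself.
  have h0 := h.euler_lagrange n (r n) 0 (h.mem_r n) ((isTestFunction_zero Ωy).memH10 hΩy).1
  have e : tensor (r n) 0 + tensor (r n) (s n) = tensor (r n) (s n) := by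
    ext z
    simp [tensor]
  rw [e, stepResidual_eq hΩx hΩy hg h.mem_r h.mem_s n
    ((h.mem_r n).tensor hΩx hΩy (h.mem_s n))] at h0
  rw [← h0, inner_grad]

end Algorithm

end GreedyPoisson

theorem mainTheorem2 (Ωx Ωy : Set ℝ)
    (hΩx_open : IsOpen Ωx) (hΩx_conn : IsConnected Ωx) (hΩx_bdd : Bornology.IsBounded Ωx)
    (hΩy_open : IsOpen Ωy) (hΩy_conn : IsConnected Ωy) (hΩy_bdd : Bornology.IsBounded Ωy)
    (f : ℝ × ℝ → ℝ) (hf : MemLp f 2 (volume.restrict (Ωx ×ˢ Ωy)))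
    (g : ℝ × ℝ → ℝ) (hg : GreedyPoisson.IsDirichletSolution (Ωx ×ˢ Ωy) f g) :
    (∀ (r s : ℕ → ℝ → ℝ) (α : ℕ → ℕ → ℝ), GreedyPoisson.IsEulerLagrangeOGA Ωx Ωy f r s α →
      (∀ n, GreedyPoisson.MemH10 (Ωx ×ˢ Ωy) (GreedyPoisson.tensor (r n) (s n))) ∧
      Summable (fun n => GreedyPoisson.dirichletNorm (Ωx ×ˢ Ωy)
        (GreedyPoisson.tensor (r n) (s n)) ^ 2) ∧
      Summable (fun n => GreedyPoisson.stepEnergy (Ωx ×ˢ Ωy) f r s α n) ∧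
      ∑' n, GreedyPoisson.dirichletNorm (Ωx ×ˢ Ωy) (GreedyPoisson.tensor (r n) (s n)) ^ 2 =
        -2 * ∑' n, GreedyPoisson.stepEnergy (Ωx ×ˢ Ωy) f r s α n) ∧
    (∀ (r s : ℕ → ℝ → ℝ) (α : ℕ → ℕ → ℝ), GreedyPoisson.IsOGA Ωx Ωy f r s α →
      (∀ n, GreedyPoisson.MemH10 (Ωx ×ˢ Ωy) (g - GreedyPoisson.tensorSum r s (α n) n)) ∧
      Tendsto (fun n => GreedyPoisson.dirichletNorm (Ωx ×ˢ Ωy)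
        (g - GreedyPoisson.tensorSum r s (α n) n)) atTop (𝓝 0)) := by
  open GreedyPoisson in
  refine ⟨fun r s α h => ?_, fun r s α h => ?_⟩
  · have hself := h.inner_self_eq hΩx_open hΩy_open hg
    have hsum := summable_norm_sq_of_galerkin
      (h.galerkin.grad_le hΩx_open hΩy_open hg h.mem_r h.mem_s) hself
    -- Since ⟨R_n, t_n⟩ = ‖t_n‖², the two series are proportional term by term.
    have hE : ∀ n, stepEnergy (Ωx ×ˢ Ωy) f r s α n =
        (-1 / 2) * ‖grad (Ωx ×ˢ Ωy) (tensor (r n) (s n))‖ ^ 2 := fun n => by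
      rw [stepEnergy, stepEnergy_eq hΩx_open hΩy_open hg h.mem_r h.mem_s n (h.mem_r n) (h.mem_s n),
        ← hself n, real_inner_self_eq_norm_sq]
      ring
    simp only [dirichletNorm_eq, hE]
    refine ⟨fun n => (h.mem_r n).tensor hΩx_open hΩy_open (h.mem_s n), hsum, hsum.mul_left _, ?_⟩
    rw [tsum_mul_left]
    ring
  · have hsub : ∀ n, g - tensorSum r s (α n) n = g + (-1 : ℝ) • tensorSum r s (α n) n :=
      fun n => by rw [neg_one_smul, sub_eq_add_neg]
    have hΩ := hΩx_open.prod hΩy_open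
    have hm := fun n => tensorSum_mem hΩx_open hΩy_open h.mem_r h.mem_s (α n) n
    have hm' := fun n => ((hm n).1.const_smul hΩ (-1)).1
    have hR : ∀ n, grad (Ωx ×ˢ Ωy) (g - tensorSum r s (α n) n) = grad (Ωx ×ˢ Ωy) g -
        ∑ k ∈ Finset.range n, α n k • grad (Ωx ×ˢ Ωy) (tensor (r k) (s k)) := fun n => by
      rw [hsub, grad_add hΩ hg.1 (hm' n), grad_const_smul hΩ (hm n).1, (hm n).2, neg_one_smul,
        sub_eq_add_neg]
    refine ⟨fun n => by rw [hsub]; exact (hg.1.add hΩ (hm' n)).1, ?_⟩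
    simp only [dirichletNorm_eq, hR]
    refine tendsto_norm_residual_of_galerkin (D := gradTensors Ωx Ωy)
      (fun d hd c => smul_mem_gradTensors hΩx_open hΩy_open hd c)
      (grad_mem_closure_span hΩx_open hΩy_open hΩx_bdd hΩy_bdd hg.1)
      (fun n => ⟨r n, s n, h.mem_r n, h.mem_s n, rfl⟩)
      (h.galerkin.grad_le hΩx_open hΩy_open hg h.mem_r h.mem_s) ?_
    rintro n _ ⟨p, q, hp, hq, rfl⟩
    have := h.minimizer n p q hp hq
    rwa [stepEnergy,
      stepEnergy_eq hΩx_open hΩy_open hg h.mem_r h.mem_s n (h.mem_r n) (h.mem_s n),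
      stepEnergy_eq hΩx_open hΩy_open hg h.mem_r h.mem_s n hp hq] at this
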